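/- Let $\mathbb R^{2,1}$ be $\mathbb R^3$ with the inner product $(x,y)=x_1y_1+x_2y_2-x_3y_3$. For an immersed surface $x:V\to\mathbb R^{2,1}$ over a domain $V\subset\mathbb C$, an immersed surface $x^\ast:V\to\mathbb R^{2,1}$ is a Christoffel dual of $x$ if the two surfaces have parallel tangent planes at corresponding points and the correspondence $dx\leftrightarrow dx^\ast$ given by this parallelism is orientation reversing and conformal. A maximal surface is a spacelike immersed surface with vanishing mean curvature. Let $a,b,c>0$ satisfy (i) $a>b>c$, (ii) $c>a>b$, or (iii) $b>c>a$, and let $p=\sqrt{\frac{a^2-b^2}{a^2-c^2}}$ and $q=\sqrt{\frac{b^2-c^2}{a^2-c^2}}$, with any choice of the complex square roots. Let $\mathrm{sn}_p,\mathrm{cn}_p,\mathrm{dn}_p$ be the Jacobi elliptic functions with modulus $p$, as meromorphic functions on $\mathbb C$. Then: (1) The map $$\alpha x(u+iv)=\frac1{\mathrm{dn}_p u\,\mathrm{sn}_q v}\begin{pmatrix}a\,\mathrm{cn}_pu\,\mathrm{cn}_qv\\ b\,\mathrm{sn}_pu\,\mathrm{dn}_qv\\ c\end{pmatrix},\qquad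 \mathrm{dn}_pu\,\mathrm{sn}_qv\neq0,$$ has as its image the whole tri-axial $2$-sheeted hyperboloid $\{(x_1/a)^2+(x_2/b)^2+1=(x_3/c)^2\}$. On the set $U$ of those points of its domain that are not zeros of $\mathrm{dn}_p$, it is a smooth immersion with curvature line (that is, orthogonal and conjugate) parameters $(u,v)$. (2) On every simply connected open $V\subset U$ there are continuous branches of the multivalued functions $$f_1=\arctan\frac1{ip\,\mathrm{sn}_p},\qquad f_2=\mathrm{artanh}\frac q{ip\,\mathrm{cn}_p},\qquad f_3=\mathrm{artanh}\Bigl(\frac qi\,\frac{\mathrm{sn}_p}{\mathrm{cn}_p}\Bigr),$$ extended continuously to the poles of $\mathrm{sn}_p$ and $\mathrm{cn}_p$ in $V$. (3) For every nonempty connected open $V\subset U$ and every choice of continuous branches $f_1,f_2,f_3$ on $V$, the map $$x^\ast=\mathrm{Re}\begin{pmatrix}\frac2p f_1\\ \frac2{pq}f_2\\ \frac2q f_3\end{pmatrix}$$ is a maximal surface on $V$. Its affine image $$\alpha x^\ast=\mathrm{Re}\begin{pmatrix}\frac{2a}p f_1\\ \frac{2b}{pq}f_2\\ \frac{2c}q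 f_3\end{pmatrix}$$ under the scaling $\alpha=\mathrm{diag}(a,b,c)$ of the axes is a Christoffel dual of $\alpha x$ on $V$, again with curvature line parameters $(u,v)$. Every Christoffel dual of $\alpha x$ on $V$ is of the form $k\,\alpha x^\ast+t$ with a real $k\neq0$ and $t\in\mathbb R^3$. -/

import Mathlib

open scoped ContDiff

noncomputable section

namespace Hyperboloid

/-! ### Jacobi elliptic functions with real parameter `m`, where `m` is the square of the modulus -/

/-- The incomplete elliptic integral of the first kind, for `m < 1`. -/
def ellipticF (m φ : ℝ) : ℝ := ∫ θ in (0 : ℝ)..φ, 1 / √(1 - m * Real.sin θ ^ 2)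

/-- The Jacobi amplitude: the inverse of the increasing bijection `ellipticF m : ℝ → ℝ`, `m < 1`. -/
def jacobiAm (m : ℝ) : ℝ → ℝ := Function.invFun (ellipticF m)

/-- `sn` at a real argument. If the modulus exceeds `1`, the reciprocal modulus is used:
`sn(u, m) = sn(√m u, 1/m) / √m`. -/
def realSn (m u : ℝ) : ℝ :=
  if m < 1 then Real.sin (jacobiAm m u) else Real.sin (jacobiAm m⁻¹ (√m * u)) / √m

/-- `cn` at a real argument; `cn(u, m) = dn(√m u, 1/m)` if the modulus exceeds `1`. -/
def realCn (m u : ℝ) : ℝ :=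
  if m < 1 then Real.cos (jacobiAm m u)
  else √(1 - m⁻¹ * Real.sin (jacobiAm m⁻¹ (√m * u)) ^ 2)

/-- `dn` at a real argument; `dn(u, m) = cn(√m u, 1/m)` if the modulus exceeds `1`. -/
def realDn (m u : ℝ) : ℝ :=
  if m < 1 then √(1 - m * Real.sin (jacobiAm m u) ^ 2)
  else Real.cos (jacobiAm m⁻¹ (√m * u))

/-- The common denominator of the Jacobi functions at `z = u + iv`; its zeros are their poles. -/
def jacobiDen (m : ℝ) (z : ℂ) : ℝ :=
  realCn (1 - m) z.im ^ 2 + m * realSn m z.re ^ 2 * realSn (1 - m) z.im ^ 2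

/-- The meromorphic function `sn` on `ℂ`, from its values at real arguments by the addition theorem
and Jacobi's imaginary transformation (value `0` at the poles). -/
def jacobiSn (m : ℝ) (z : ℂ) : ℂ :=
  ((realSn m z.re * realDn (1 - m) z.im : ℝ)
    + Complex.I * (realCn m z.re * realDn m z.re * realSn (1 - m) z.im * realCn (1 - m) z.im : ℝ))
  / (jacobiDen m z : ℂ)

/-- The meromorphic function `cn` on `ℂ` (value `0` at the poles). -/
def jacobiCn (m : ℝ) (z : ℂ) : ℂ :=
  ((realCn m z.re * realCn (1 - m) z.im : ℝ)
    - Complex.I * (realSn m z.re * realDn m z.re * realSn (1 - m) z.im * realDn (1 - m) z.im : ℝ))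
  / (jacobiDen m z : ℂ)

/-- The meromorphic function `dn` on `ℂ` (value `0` at the poles). -/
def jacobiDn (m : ℝ) (z : ℂ) : ℂ :=
  ((realDn m z.re * realCn (1 - m) z.im * realDn (1 - m) z.im : ℝ)
    - Complex.I * (m * realSn m z.re * realCn m z.re * realSn (1 - m) z.im : ℝ))
  / (jacobiDen m z : ℂ)

/-! ### Surfaces in Minkowski space `ℝ^{2,1}`, parametrized over domains of `ℂ`, `z = u + iv` -/

/-- The Minkowski inner product of signature `(+,+,-)`. -/
def mink (X Y : Fin 3 → ℝ) : ℝ := X 0 * Y 0 + X 1 * Y 1 - X 2 * Y 2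

/-- The determinant of three vectors. -/
def det3 (X Y Z : Fin 3 → ℝ) : ℝ := Matrix.det !![X 0, X 1, X 2; Y 0, Y 1, Y 2; Z 0, Z 1, Z 2]

/-- The partial derivative `x_u`. -/
def dU (x : ℂ → Fin 3 → ℝ) (z : ℂ) : Fin 3 → ℝ := fderiv ℝ x z 1

/-- The partial derivative `x_v`. -/
def dV (x : ℂ → Fin 3 → ℝ) (z : ℂ) : Fin 3 → ℝ := fderiv ℝ x z Complex.I

/-- A smooth immersed surface over `V` (its induced metric may have any causal type). -/
structure IsImmersedSurface (V : Set ℂ) (x : ℂ → Fin 3 → ℝ) : Prop where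
  smooth : ContDiffOn ℝ ∞ x V
  immersed : ∀ z ∈ V, Function.Injective (fderiv ℝ x z)

/-- `(u, v)` are curvature line parameters: orthogonal and conjugate. -/
def IsCurvatureLineParametrization (V : Set ℂ) (x : ℂ → Fin 3 → ℝ) : Prop :=
  IsImmersedSurface V x ∧ ∀ z ∈ V,
    mink (dU x z) (dV x z) = 0 ∧ det3 (dV (dU x) z) (dU x z) (dV x z) = 0

/-- The mean curvature `(E N - 2 F M + G L) / (2 (E G - F²))` of a surface with nondegenerate
metric. The coefficients of the second fundamental form are taken for the unit normal
`n = (x_u × x_v) / √|E G - F²|`, with the Lorentzian cross product: `⟨w, x_u × x_v⟩ = det (w, x_u, x_v)`. -/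
def meanCurvature (x : ℂ → Fin 3 → ℝ) (z : ℂ) : ℝ :=
  let E := mink (dU x z) (dU x z)
  let F := mink (dU x z) (dV x z)
  let G := mink (dV x z) (dV x z)
  let L := det3 (dU (dU x) z) (dU x z) (dV x z) / √|E * G - F ^ 2|
  let M := det3 (dV (dU x) z) (dU x z) (dV x z) / √|E * G - F ^ 2|
  let N := det3 (dV (dV x) z) (dU x z) (dV x z) / √|E * G - F ^ 2|
  (E * N - 2 * F * M + G * L) / (2 * (E * G - F ^ 2))

/-- A maximal surface: an immersed spacelike surface whose mean curvature vanishes. -/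
structure IsMaximalSurface (V : Set ℂ) (x : ℂ → Fin 3 → ℝ) : Prop where
  surface : IsImmersedSurface V x
  spacelike : ∀ z ∈ V, ∀ X : ℂ, X ≠ 0 → 0 < mink (fderiv ℝ x z X) (fderiv ℝ x z X)
  mean_zero : ∀ z ∈ V, meanCurvature x z = 0

/-- `xs` is a Christoffel dual of `x`: the two surfaces have parallel tangent planes at
corresponding points, `dxs = dx ∘ S`, and the correspondence by parallel tangent planes reverses
orientation (`det S < 0`) and is conformal for the induced metrics. -/
structure IsChristoffelDual (V : Set ℂ) (x xs : ℂ → Fin 3 → ℝ) : Prop where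
  surface : IsImmersedSurface V x
  surface_dual : IsImmersedSurface V xs
  parallel_reversing : ∀ z ∈ V, ∃ S : ℂ →L[ℝ] ℂ, S.det < 0 ∧ fderiv ℝ xs z = (fderiv ℝ x z).comp S
  conformal : ∀ z ∈ V, ∃ l : ℝ, 0 < l ∧ ∀ X Y : ℂ,
    mink (fderiv ℝ xs z X) (fderiv ℝ xs z Y) = l * mink (fderiv ℝ x z X) (fderiv ℝ x z Y)

/-! ### The hyperboloid and its dual -/

/-- The `2`-sheeted hyperboloid with timelike axis and half axes `a`, `b`, `c`. -/
def twoSheetedHyperboloid (a b c : ℝ) : Set (Fin 3 → ℝ) :=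
  {X | (X 0 / a) ^ 2 + (X 1 / b) ^ 2 + 1 = (X 2 / c) ^ 2}

/-- The points where the parametrization of the hyperboloid by Jacobi functions is defined. -/
def paramDomain (m : ℝ) : Set ℂ := {z | realDn m z.re * realSn (1 - m) z.im ≠ 0}

/-- `u + iv ↦ (a cn u cn' v, b sn u dn' v, c) / (dn u sn' v)`, where the prime marks the
complementary modulus. -/
def hyperboloidParam (a b c m : ℝ) (z : ℂ) : Fin 3 → ℝ :=
  (1 / (realDn m z.re * realSn (1 - m) z.im)) •
    ![a * realCn m z.re * realCn (1 - m) z.im, b * realSn m z.re * realDn (1 - m) z.im, c]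

/-- The parameter domain without the zeros of `dn` (which give the umbilics). -/
def regularDomain (m : ℝ) : Set ℂ :=
  {z | z ∈ paramDomain m ∧ (jacobiDen m z ≠ 0 → jacobiDn m z ≠ 0)}

/-- `f₁, f₂, f₃` are continuous determinations on `V` of the multivalued functions
`arctan (1 / (i p sn))`, `artanh (q / (i p cn))` and `artanh ((q / i) (sn / cn))`
(extended continuously to those poles of `sn` and `cn` that lie in `V`). -/
structure IsBranch (m : ℝ) (p q : ℂ) (V : Set ℂ) (f₁ f₂ f₃ : ℂ → ℂ) : Prop where
  cont₁ : ContinuousOn f₁ V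
  cont₂ : ContinuousOn f₂ V
  cont₃ : ContinuousOn f₃ V
  tan₁ : ∀ z ∈ V, jacobiDen m z ≠ 0 →
    Complex.tan (f₁ z) = 1 / (Complex.I * p * jacobiSn m z)
  tanh₂ : ∀ z ∈ V, jacobiDen m z ≠ 0 →
    Complex.tanh (f₂ z) = q / (Complex.I * p * jacobiCn m z)
  tanh₃ : ∀ z ∈ V, jacobiDen m z ≠ 0 →
    Complex.tanh (f₃ z) = q / Complex.I * (jacobiSn m z / jacobiCn m z)

/-- `Re ((2a/p) f₁, (2b/(pq)) f₂, (2c/q) f₃)`. -/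
def dualFormula (a b c : ℝ) (p q : ℂ) (f₁ f₂ f₃ : ℂ → ℂ) (z : ℂ) : Fin 3 → ℝ :=
  ![(2 * a / p * f₁ z).re, (2 * b / (p * q) * f₂ z).re, (2 * c / q * f₃ z).re]

/-- The affine transformation that scales the axes by `a`, `b`, `c`. -/
def scaleAxes (a b c : ℝ) : (Fin 3 → ℝ) →ᵃ[ℝ] (Fin 3 → ℝ) :=
  (Matrix.toLin' (Matrix.diagonal ![a, b, c])).toAffineMap

end Hyperboloid

end

/-!
The vector `ξ = (cn u cn' v, sn u dn' v, dn u sn' v)`, with primes for the complementary modulus,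
lies on the unit sphere (`sphere_identity`), and the parametrization of the hyperboloid is the
projective image `(a ξ₁, b ξ₂, c) / ξ₃`. So the image is the whole hyperboloid because `σ = sn² u`
and `τ = sn'² v` are elliptic coordinates on the sphere: they come from the two roots of a
quadratic polynomial that are separated by the middle one of `0`, `1`, `1 / m`
(`exists_spheroconal`). The map `ξ` is conformal with factor `dn² u - (1 - m) sn'² v`, which
vanishes exactly at the zeros of `dn` (`conformalFactor_pos`).

The functions `1 / sn`, `1 / cn` and `sn / cn` have explicit expressions whose denominators
`1 - ξ₁²` and `1 - ξ₂²` do not vanish where `ξ₃ ≠ 0`, so they are holomorphic across the poles, and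
the arguments of `arctan` and `artanh` avoid the branch points. Hence branches exist on simply
connected domains, and all continuous branches are holomorphic with the derivatives `-ip cn / dn`,
`-ipq sn / dn` and `-iq / dn`. The formula for the dual surface thus has the differential
`Re (-2i (a cn, b sn, c) / dn dz)`. Its coefficients turn out to be real
multiples of the tangent vectors
of the hyperboloid: the partial derivatives of the dual are `λ x_u` and `-λ x_v` with
`λ = 2 ξ₃² / (dn² u - (1 - m) sn'² v) > 0` (`hasFDerivAt_dualFormula`), which is the duality. For
`a = b = c = 1` the surface is harmonic with isothermal parameters, hence maximal.

For the uniqueness, let `y` be any Christoffel dual. Equality of the mixed derivatives of `y`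
makes the correspondence of the tangent planes symmetric for the second fundamental form of the
hyperboloid, a multiple of `du² + dv²`. Since `x_u` and `x_v` have different square lengths, a
symmetric, conformal, orientation reversing correspondence must be `y_u = k x_u`, `y_v = -k x_v`,
wherever the induced metric is nondegenerate (`IsChristoffelDual.exists_smul`). Such points are
dense, so by continuity the differential of `y` is everywhere a multiple of that of the dual
surface, and the factor is constant (`exists_eq_smul_add`).
-/

noncomputable section

namespace Hyperboloid

/-! ### Jacobi elliptic functions at real arguments -/

lemma one_sub_mul_sin_sq_pos {m : ℝ} (hm : m < 1) (θ : ℝ) : 0 < 1 - m * Real.sin θ ^ 2 := by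
  rcases le_or_gt m 0 with h | h <;> nlinarith [Real.sin_sq_le_one θ, sq_nonneg (Real.sin θ)]

lemma continuous_ellipticF_integrand {m : ℝ} (hm : m < 1) :
    Continuous fun θ : ℝ => 1 / √(1 - m * Real.sin θ ^ 2) := by
  refine continuous_const.div (by fun_prop) fun θ => ?_
  exact (Real.sqrt_pos.2 (one_sub_mul_sin_sq_pos hm θ)).ne'

lemma hasDerivAt_ellipticF {m : ℝ} (hm : m < 1) (φ : ℝ) :
    HasDerivAt (ellipticF m) (1 / √(1 - m * Real.sin φ ^ 2)) φ :=
  (continuous_ellipticF_integrand hm).integral_hasStrictDerivAt 0 φ |>.hasDerivAt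

lemma strictMono_ellipticF {m : ℝ} (hm : m < 1) : StrictMono (ellipticF m) :=
  strictMono_of_hasDerivAt_pos (hasDerivAt_ellipticF hm) fun φ =>
    one_div_pos.2 (Real.sqrt_pos.2 (one_sub_mul_sin_sq_pos hm φ))

lemma surjective_ellipticF {m : ℝ} (hm : m < 1) : Function.Surjective (ellipticF m) := by
  set k : ℝ := 1 / √(1 + |m|) with hk
  have hk0 : 0 < k := by positivity
  -- the integrand is bounded below by `k`, so `ellipticF m φ - k φ` is monotone
  have hle : ∀ φ, k ≤ 1 / √(1 - m * Real.sin φ ^ 2) := fun φ => by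
    have h0 := one_sub_mul_sin_sq_pos hm φ
    refine one_div_le_one_div_of_le (Real.sqrt_pos.2 h0) (Real.sqrt_le_sqrt ?_)
    nlinarith [Real.sin_sq_le_one φ, sq_nonneg (Real.sin φ), neg_abs_le m, abs_nonneg m]
  have hd : ∀ φ, HasDerivAt (fun φ => ellipticF m φ - k * φ)
      (1 / √(1 - m * Real.sin φ ^ 2) - k * 1) φ := fun φ =>
    (hasDerivAt_ellipticF hm φ).sub ((hasDerivAt_id φ).const_mul k)
  have hmono : Monotone fun φ => ellipticF m φ - k * φ :=
    monotone_of_hasDerivAt_nonneg hd fun φ => by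
      rw [mul_one]; exact sub_nonneg.2 (hle φ)
  have h0 : ellipticF m 0 = 0 := by simp [ellipticF]
  refine Continuous.surjective
    (continuous_iff_continuousAt.2 fun φ => (hasDerivAt_ellipticF hm φ).continuousAt) ?_ ?_
  · refine Filter.tendsto_atTop_mono' _ ?_ (Filter.tendsto_id.const_mul_atTop hk0)
    filter_upwards [Filter.eventually_ge_atTop 0] with φ hφ
    have := hmono hφ
    simp only [h0, id] at this ⊢
    linarith
  · refine Filter.tendsto_atBot_mono' _ ?_ (Filter.tendsto_id.const_mul_atBot hk0)
    filter_upwards [Filter.eventually_le_atBot 0] with φ hφ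
    have := hmono hφ
    simp only [h0, id] at this ⊢
    linarith

lemma ellipticF_jacobiAm {m : ℝ} (hm : m < 1) (u : ℝ) : ellipticF m (jacobiAm m u) = u :=
  Function.rightInverse_invFun (surjective_ellipticF hm) u

lemma jacobiAm_ellipticF {m : ℝ} (hm : m < 1) (φ : ℝ) : jacobiAm m (ellipticF m φ) = φ :=
  Function.leftInverse_invFun (strictMono_ellipticF hm).injective φ

lemma continuous_jacobiAm {m : ℝ} (hm : m < 1) : Continuous (jacobiAm m) := by
  have h : jacobiAm m
      = ((strictMono_ellipticF hm).orderIsoOfSurjective _ (surjective_ellipticF hm)).symm := by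
    funext u
    rw [← OrderIso.symm_apply_apply
      ((strictMono_ellipticF hm).orderIsoOfSurjective _ (surjective_ellipticF hm)) (jacobiAm m u)]
    simp [ellipticF_jacobiAm hm]
  rw [h]
  exact OrderIso.continuous _

lemma hasDerivAt_jacobiAm {m : ℝ} (hm : m < 1) (u : ℝ) :
    HasDerivAt (jacobiAm m) (√(1 - m * Real.sin (jacobiAm m u) ^ 2)) u := by
  have hpos := Real.sqrt_pos.2 (one_sub_mul_sin_sq_pos hm (jacobiAm m u))
  have := HasDerivAt.of_local_left_inverse (continuous_jacobiAm hm).continuousAt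
    (hasDerivAt_ellipticF hm (jacobiAm m u)) (one_div_pos.2 hpos).ne'
    (Filter.Eventually.of_forall (ellipticF_jacobiAm hm))
  simpa using this

lemma inv_lt_one_of_not_lt {m : ℝ} (hm : m ≠ 1) (h : ¬ m < 1) : m⁻¹ < 1 :=
  inv_lt_one_of_one_lt₀ (lt_of_le_of_ne (not_lt.1 h) hm.symm)

lemma realSn_sq_add_realCn_sq {m : ℝ} (hm : m ≠ 1) (u : ℝ) :
    realSn m u ^ 2 + realCn m u ^ 2 = 1 := by
  unfold realSn realCn
  split_ifs with h
  · exact Real.sin_sq_add_cos_sq _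
  · have h1 := inv_lt_one_of_not_lt hm h
    rw [Real.sq_sqrt (one_sub_mul_sin_sq_pos h1 _).le, div_pow, Real.sq_sqrt (by linarith)]
    field_simp
    ring

lemma realDn_sq_add {m : ℝ} (u : ℝ) :
    realDn m u ^ 2 + m * realSn m u ^ 2 = 1 := by
  unfold realSn realDn
  split_ifs with h
  · rw [Real.sq_sqrt (one_sub_mul_sin_sq_pos h _).le]
    ring
  · have h0 : m ≠ 0 := by linarith
    rw [div_pow, Real.sq_sqrt (by linarith), mul_div_cancel₀ _ h0]
    exact Real.cos_sq_add_sin_sq _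

lemma realDn_pos {m : ℝ} (hm : m < 1) (u : ℝ) : 0 < realDn m u := by
  rw [realDn, if_pos hm]
  exact Real.sqrt_pos.2 (one_sub_mul_sin_sq_pos hm _)

lemma realCn_pos {m : ℝ} (hm : 1 < m) (u : ℝ) : 0 < realCn m u := by
  rw [realCn, if_neg hm.not_gt]
  exact Real.sqrt_pos.2 (one_sub_mul_sin_sq_pos (inv_lt_one_of_one_lt₀ hm) _)

lemma hasDerivAt_sqrt_jacobiAm {m : ℝ} (hm : m < 1) (u : ℝ) :
    HasDerivAt (fun u => √(1 - m * Real.sin (jacobiAm m u) ^ 2))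
      (-m * Real.sin (jacobiAm m u) * Real.cos (jacobiAm m u)) u := by
  have hpos := one_sub_mul_sin_sq_pos hm (jacobiAm m u)
  have h := (((((hasDerivAt_jacobiAm hm u).sin).pow 2).const_mul m).const_sub 1).sqrt hpos.ne'
  refine h.congr_deriv ?_
  have := (Real.sqrt_pos.2 hpos).ne'
  simp only [Pi.pow_apply]
  field_simp
  push_cast
  ring

lemma hasDerivAt_realSn {m : ℝ} (hm : m ≠ 1) (u : ℝ) :
    HasDerivAt (realSn m) (realCn m u * realDn m u) u := by
  by_cases h : m < 1
  · have e : realSn m = fun u => Real.sin (jacobiAm m u) := by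
      funext u; rw [realSn, if_pos h]
    rw [e, realCn, realDn, if_pos h, if_pos h]
    exact (hasDerivAt_jacobiAm h u).sin
  · have h1 := inv_lt_one_of_not_lt hm h
    have e : realSn m = fun u => Real.sin (jacobiAm m⁻¹ (√m * u)) / √m := by
      funext u; rw [realSn, if_neg h]
    have h0 : √m ≠ 0 := (Real.sqrt_pos.2 (by linarith)).ne'
    rw [e, realCn, realDn, if_neg h, if_neg h]
    have := ((((hasDerivAt_jacobiAm h1 (√m * u)).comp u
      ((hasDerivAt_id u).const_mul (√m))).sin).div_const (√m))
    refine this.congr_deriv ?_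
    simp only [Function.comp]
    field_simp

lemma hasDerivAt_realCn {m : ℝ} (hm : m ≠ 1) (u : ℝ) :
    HasDerivAt (realCn m) (-(realSn m u * realDn m u)) u := by
  by_cases h : m < 1
  · have e : realCn m = fun u => Real.cos (jacobiAm m u) := by
      funext u; rw [realCn, if_pos h]
    rw [e, realSn, realDn, if_pos h, if_pos h]
    exact (hasDerivAt_jacobiAm h u).cos.congr_deriv (by ring)
  · have h1 := inv_lt_one_of_not_lt hm h
    have e : realCn m = fun u => √(1 - m⁻¹ * Real.sin (jacobiAm m⁻¹ (√m * u)) ^ 2) := by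
      funext u; rw [realCn, if_neg h]
    have h0 : √m ≠ 0 := (Real.sqrt_pos.2 (by linarith)).ne'
    have h2 : √m ^ 2 = m := Real.sq_sqrt (by linarith)
    rw [e, realSn, realDn, if_neg h, if_neg h]
    have := (hasDerivAt_sqrt_jacobiAm h1 (√m * u)).comp u ((hasDerivAt_id u).const_mul (√m))
    refine this.congr_deriv ?_
    generalize √(1 - m⁻¹ * Real.sin (jacobiAm m⁻¹ (√m * u)) ^ 2) = r
    have h3 : m⁻¹ * √m = 1 / √m := by
      rw [inv_mul_eq_div, div_eq_div_iff (by linarith) h0, one_mul, ← sq, h2]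
    linear_combination (-Real.sin (jacobiAm m⁻¹ (√m * u)) * Real.cos (jacobiAm m⁻¹ (√m * u))) * h3

lemma hasDerivAt_realDn {m : ℝ} (hm : m ≠ 1) (u : ℝ) :
    HasDerivAt (realDn m) (-(m * realSn m u * realCn m u)) u := by
  by_cases h : m < 1
  · have e : realDn m = fun u => √(1 - m * Real.sin (jacobiAm m u) ^ 2) := by
      funext u; rw [realDn, if_pos h]
    rw [e, realSn, realCn, if_pos h, if_pos h]
    exact (hasDerivAt_sqrt_jacobiAm h u).congr_deriv (by ring)
  · have h1 := inv_lt_one_of_not_lt hm h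
    have e : realDn m = fun u => Real.cos (jacobiAm m⁻¹ (√m * u)) := by
      funext u; rw [realDn, if_neg h]
    have h0 : √m ≠ 0 := (Real.sqrt_pos.2 (by linarith)).ne'
    have h2 : √m ^ 2 = m := Real.sq_sqrt (by linarith)
    rw [e, realSn, realCn, if_neg h, if_neg h]
    have := (((hasDerivAt_jacobiAm h1 (√m * u)).comp u
      ((hasDerivAt_id u).const_mul (√m))).cos)
    refine this.congr_deriv ?_
    simp only [Function.comp]
    generalize √(1 - m⁻¹ * Real.sin (jacobiAm m⁻¹ (√m * u)) ^ 2) = r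
    field_simp
    rw [h2]

/-- The functions `sn`, `cn`, `dn` are smooth: their derivatives are polynomials in them. -/
lemma contDiff_jacobi_nat {m : ℝ} (hm : m ≠ 1) (n : ℕ) :
    ContDiff ℝ n (realSn m) ∧ ContDiff ℝ n (realCn m) ∧ ContDiff ℝ n (realDn m) := by
  have dS : deriv (realSn m) = fun u => realCn m u * realDn m u :=
    funext fun u => (hasDerivAt_realSn hm u).deriv
  have dC : deriv (realCn m) = fun u => -(realSn m u * realDn m u) :=
    funext fun u => (hasDerivAt_realCn hm u).deriv
  have dD : deriv (realDn m) = fun u => -(m * realSn m u * realCn m u) :=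
    funext fun u => (hasDerivAt_realDn hm u).deriv
  induction n with
  | zero =>
    simp only [CharP.cast_eq_zero, contDiff_zero]
    exact ⟨continuous_iff_continuousAt.2 fun u => (hasDerivAt_realSn hm u).continuousAt,
      continuous_iff_continuousAt.2 fun u => (hasDerivAt_realCn hm u).continuousAt,
      continuous_iff_continuousAt.2 fun u => (hasDerivAt_realDn hm u).continuousAt⟩
  | succ n ih =>
    obtain ⟨h1, h2, h3⟩ := ih
    push_cast
    simp only [contDiff_succ_iff_deriv, dS, dC, dD]
    refine ⟨⟨fun u => (hasDerivAt_realSn hm u).differentiableAt, by simp, by fun_prop⟩,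
      ⟨fun u => (hasDerivAt_realCn hm u).differentiableAt, by simp, by fun_prop⟩,
      ⟨fun u => (hasDerivAt_realDn hm u).differentiableAt, by simp, by fun_prop⟩⟩

lemma contDiff_realSn {m : ℝ} (hm : m ≠ 1) : ContDiff ℝ ∞ (realSn m) :=
  contDiff_infty.2 fun n => (contDiff_jacobi_nat hm n).1

lemma contDiff_realCn {m : ℝ} (hm : m ≠ 1) : ContDiff ℝ ∞ (realCn m) :=
  contDiff_infty.2 fun n => (contDiff_jacobi_nat hm n).2.1

lemma contDiff_realDn {m : ℝ} (hm : m ≠ 1) : ContDiff ℝ ∞ (realDn m) :=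
  contDiff_infty.2 fun n => (contDiff_jacobi_nat hm n).2.2

/-- Below modulus `1`, `(sn, cn)` runs through the whole unit circle. -/
lemma exists_realSn_realCn {m S C : ℝ} (hm : m < 1) (h : S ^ 2 + C ^ 2 = 1) :
    ∃ u, realSn m u = S ∧ realCn m u = C := by
  obtain ⟨φ, hC, hS⟩ : ∃ φ, Real.cos φ = C ∧ Real.sin φ = S := by
    have hn : ‖(⟨C, S⟩ : ℂ)‖ = 1 := by
      rw [Complex.norm_def, Complex.normSq_mk, Real.sqrt_eq_one]; linarith
    have hz : (⟨C, S⟩ : ℂ) ≠ 0 := by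
      intro h0; rw [h0] at hn; simp at hn
    exact ⟨Complex.arg ⟨C, S⟩, by rw [Complex.cos_arg hz, hn, div_one],
      by rw [Complex.sin_arg, hn, div_one]⟩
  refine ⟨ellipticF m φ, ?_, ?_⟩
  · rw [realSn, if_pos hm, jacobiAm_ellipticF hm, hS]
  · rw [realCn, if_pos hm, jacobiAm_ellipticF hm, hC]

/-- Above modulus `1`, `(√m sn, dn)` runs through the whole unit circle. -/
lemma exists_realSn_realDn {m S D : ℝ} (hm : 1 < m) (h : m * S ^ 2 + D ^ 2 = 1) :
    ∃ u, realSn m u = S ∧ realDn m u = D := by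
  have h0 : 0 < √m := Real.sqrt_pos.2 (by linarith)
  have h1 : m⁻¹ < 1 := inv_lt_one_of_one_lt₀ hm
  obtain ⟨u, hu, hv⟩ := exists_realSn_realCn (S := √m * S) (C := D) h1
    (by rw [mul_pow, Real.sq_sqrt (by linarith), h])
  rw [realSn, if_pos h1] at hu
  rw [realCn, if_pos h1] at hv
  refine ⟨u / √m, ?_, ?_⟩
  · rw [realSn, if_neg hm.not_gt, mul_div_cancel₀ _ h0.ne', hu, mul_div_cancel_left₀ _ h0.ne']
  · rw [realDn, if_neg hm.not_gt, mul_div_cancel₀ _ h0.ne', hv]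

/-! ### Quotients of Jacobi functions that are holomorphic on the parameter domain -/

/-- `dn² u - (1 - m) sn'² v`, which is `|dn z|²` times the common denominator `jacobiDen`. It is
the conformal factor of the map `(cn u cn' v, sn u dn' v, dn u sn' v)` into the unit sphere. -/
def conformalFactor (m : ℝ) (z : ℂ) : ℝ :=
  1 - m * realSn m z.re ^ 2 - (1 - m) * realSn (1 - m) z.im ^ 2

/-- The function `1 / sn` on the parameter domain, including the poles of `sn`. -/
def invSn (m : ℝ) (z : ℂ) : ℂ :=
  (realSn m z.re * realDn (1 - m) z.im
    - Complex.I * (realCn m z.re * realDn m z.re * realSn (1 - m) z.im * realCn (1 - m) z.im))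
  / (1 - (realCn m z.re * realCn (1 - m) z.im : ℂ) ^ 2)

/-- The function `1 / cn` on the parameter domain, including the poles of `cn`. -/
def invCn (m : ℝ) (z : ℂ) : ℂ :=
  (realCn m z.re * realCn (1 - m) z.im
    + Complex.I * (realSn m z.re * realDn m z.re * realSn (1 - m) z.im * realDn (1 - m) z.im))
  / (1 - (realSn m z.re * realDn (1 - m) z.im : ℂ) ^ 2)

/-- The function `sn / cn` on the parameter domain, including the common poles. -/
def snDivCn (m : ℝ) (z : ℂ) : ℂ :=
  (realSn m z.re * realCn m z.re * realCn (1 - m) z.im * realDn (1 - m) z.im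
    + Complex.I * (realDn m z.re * realSn (1 - m) z.im))
  / (1 - (realSn m z.re * realDn (1 - m) z.im : ℂ) ^ 2)

/-- The function `cn / dn`, including the common poles. -/
def cnDivDn (m : ℝ) (z : ℂ) : ℂ :=
  (realCn m z.re * realDn m z.re * realDn (1 - m) z.im
    - Complex.I * ((1 - m) * realSn m z.re * realSn (1 - m) z.im * realCn (1 - m) z.im))
  / conformalFactor m z

/-- The function `sn / dn`, including the common poles. -/
def snDivDn (m : ℝ) (z : ℂ) : ℂ :=
  (realSn m z.re * realDn m z.re * realCn (1 - m) z.im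
    + Complex.I * (realCn m z.re * realSn (1 - m) z.im * realDn (1 - m) z.im))
  / conformalFactor m z

/-- The function `1 / dn`, including the poles of `dn`. -/
def invDn (m : ℝ) (z : ℂ) : ℂ :=
  (realDn m z.re * realCn (1 - m) z.im * realDn (1 - m) z.im
    + Complex.I * (m * realSn m z.re * realCn m z.re * realSn (1 - m) z.im))
  / conformalFactor m z

lemma one_sub_ne_one {m : ℝ} (hm : m ≠ 0) : 1 - m ≠ 1 := by simpa using hm

/-- The point `(cn u cn' v, sn u dn' v, dn u sn' v)` lies on the unit sphere. -/
lemma sphere_identity {m : ℝ} (hm0 : m ≠ 0) (hm1 : m ≠ 1) (u v : ℝ) :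
    (realCn m u * realCn (1 - m) v) ^ 2 + (realSn m u * realDn (1 - m) v) ^ 2
      + (realDn m u * realSn (1 - m) v) ^ 2 = 1 := by
  have h1 := realSn_sq_add_realCn_sq hm1 u
  have h2 := realDn_sq_add (m := m) u
  have h3 := realSn_sq_add_realCn_sq (one_sub_ne_one hm0) v
  have h4 := realDn_sq_add (m := 1 - m) v
  grind

lemma jacobiDen_eq {m : ℝ} (hm0 : m ≠ 0) (z : ℂ) :
    jacobiDen m z = 1 - (realDn m z.re * realSn (1 - m) z.im) ^ 2 := by
  have h2 := realDn_sq_add (m := m) z.re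
  have h3 := realSn_sq_add_realCn_sq (one_sub_ne_one hm0) z.im
  unfold jacobiDen
  grind

lemma one_sub_cn_sq_pos {m : ℝ} (hm0 : m ≠ 0) (hm1 : m ≠ 1) {z : ℂ} (hz : z ∈ paramDomain m) :
    0 < 1 - (realCn m z.re * realCn (1 - m) z.im) ^ 2 := by
  have h := sphere_identity hm0 hm1 z.re z.im
  have h3 : 0 < (realDn m z.re * realSn (1 - m) z.im) ^ 2 := sq_pos_iff.2 hz
  nlinarith [sq_nonneg (realSn m z.re * realDn (1 - m) z.im)]

lemma one_sub_sn_sq_pos {m : ℝ} (hm0 : m ≠ 0) (hm1 : m ≠ 1) {z : ℂ} (hz : z ∈ paramDomain m) :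
    0 < 1 - (realSn m z.re * realDn (1 - m) z.im) ^ 2 := by
  have h := sphere_identity hm0 hm1 z.re z.im
  have h3 : 0 < (realDn m z.re * realSn (1 - m) z.im) ^ 2 := sq_pos_iff.2 hz
  nlinarith [sq_nonneg (realCn m z.re * realCn (1 - m) z.im)]

/-- The conformal factor is positive away from the umbilics. The sign of each of the three forms
of the conformal factor used here depends on which of `m`, `1 - m` lies in `(0, 1)`. -/
lemma conformalFactor_pos {m : ℝ} (hm0 : m ≠ 0) (hm1 : m ≠ 1) {z : ℂ}
    (hz : z ∈ regularDomain m) : 0 < conformalFactor m z := by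
  obtain ⟨hz, hdn⟩ := hz
  have hz' : realDn m z.re * realSn (1 - m) z.im ≠ 0 := hz
  have h1 := realSn_sq_add_realCn_sq hm1 z.re
  have h2 := realDn_sq_add (m := m) z.re
  have h3 := realSn_sq_add_realCn_sq (one_sub_ne_one hm0) z.im
  have h4 := realDn_sq_add (m := 1 - m) z.im
  unfold conformalFactor
  unfold jacobiDn jacobiDen at hdn
  generalize realSn m z.re = S at *
  generalize realCn m z.re = C at *
  generalize realDn m z.re = D at *
  generalize realSn (1 - m) z.im = s at *
  generalize realCn (1 - m) z.im = c at *
  generalize realDn (1 - m) z.im = d at *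
  have hD : D ≠ 0 := left_ne_zero_of_mul hz'
  have hs : s ≠ 0 := right_ne_zero_of_mul hz'
  have hD' : 0 < D ^ 2 := by positivity
  have hs' : 0 < s ^ 2 := by positivity
  have hm : 0 < m ^ 2 := by positivity
  have hm' : 0 < (1 - m) ^ 2 := by have := sub_ne_zero.2 hm1.symm; positivity
  -- the squared norm of the numerator of `dn` is the conformal factor times `jacobiDen`
  have hne : 1 - m * S ^ 2 - (1 - m) * s ^ 2 ≠ 0 := by
    intro hW
    have hnum : (D * c * d) ^ 2 + (m * S * C * s) ^ 2
        = (1 - m * S ^ 2 - (1 - m) * s ^ 2) * (c ^ 2 + m * S ^ 2 * s ^ 2) := by grind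
    rw [hW, zero_mul] at hnum
    have n1 : D * c * d = 0 := by nlinarith [sq_nonneg (D * c * d), sq_nonneg (m * S * C * s)]
    have n2 : m * S * C * s = 0 := by nlinarith [sq_nonneg (D * c * d), sq_nonneg (m * S * C * s)]
    have hden : c ^ 2 + m * S ^ 2 * s ^ 2 = 0 := by
      by_contra h0
      refine hdn h0 ?_
      rw [n1, show m * S * C * s = 0 from n2]
      simp
    have hsph : (C * c) ^ 2 + (S * d) ^ 2 = c ^ 2 + m * S ^ 2 * s ^ 2 := by grind
    rw [hden] at hsph
    have n3 : C * c = 0 := by nlinarith [sq_nonneg (C * c), sq_nonneg (S * d)]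
    have n4 : S * d = 0 := by nlinarith [sq_nonneg (C * c), sq_nonneg (S * d)]
    grind
  have hnn : 0 ≤ 1 - m * S ^ 2 - (1 - m) * s ^ 2 := by
    rcases le_or_gt m 0 with h | h
    · nlinarith [sq_nonneg S, sq_nonneg d]
    · rcases le_or_gt m 1 with h' | h'
      · nlinarith [sq_nonneg C, sq_nonneg c]
      · nlinarith [sq_nonneg s, sq_nonneg D]
  exact lt_of_le_of_ne hnn hne.symm

lemma hasFDerivAt_div {𝔸 : Type*} [NormedField 𝔸] [NormedAlgebra ℝ 𝔸] {N Q : ℂ → 𝔸}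
    {N' Q' : ℂ →L[ℝ] 𝔸} {z : ℂ} (hN : HasFDerivAt N N' z) (hQ : HasFDerivAt Q Q' z)
    (h0 : Q z ≠ 0) :
    HasFDerivAt (fun w => N w / Q w) ((Q z ^ 2)⁻¹ • (Q z • N' - N z • Q')) z := by
  simp only [div_eq_mul_inv]
  refine (hN.mul ((hasFDerivAt_inv' h0).comp z hQ)).congr_fderiv ?_
  ext X
  simp
  field_simp
  ring

lemma hasFDerivAt_ofReal_re {g : ℝ → ℝ} {g' : ℝ} {z : ℂ} (h : HasDerivAt g g' z.re) :
    HasFDerivAt (fun w : ℂ => (g w.re : ℂ)) ((g' : ℂ) • Complex.ofRealCLM.comp Complex.reCLM)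
      z := by
  refine ((Complex.ofRealCLM.hasFDerivAt.comp _
    (h.hasFDerivAt.comp z Complex.reCLM.hasFDerivAt))).congr_fderiv ?_
  ext X
  simp [mul_comm]

lemma hasFDerivAt_ofReal_im {g : ℝ → ℝ} {g' : ℝ} {z : ℂ} (h : HasDerivAt g g' z.im) :
    HasFDerivAt (fun w : ℂ => (g w.im : ℂ)) ((g' : ℂ) • Complex.ofRealCLM.comp Complex.imCLM)
      z := by
  refine ((Complex.ofRealCLM.hasFDerivAt.comp _
    (h.hasFDerivAt.comp z Complex.imCLM.hasFDerivAt))).congr_fderiv ?_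
  ext X
  simp [mul_comm]

/-- The Cauchy-Riemann equations, read off from the values of the real derivative. -/
lemma hasDerivAt_of_hasFDerivAt_real {f : ℂ → ℂ} {L : ℂ →L[ℝ] ℂ} {f' z : ℂ}
    (h : HasFDerivAt f L z) (h1 : L 1 = f' * 1) (hI : L Complex.I = f' * Complex.I) :
    HasDerivAt f f' z := by
  rw [hasDerivAt_iff_hasFDerivAt]
  refine hasFDerivAt_of_restrictScalars ℝ h ?_
  ext X
  have e : X = X.re • (1 : ℂ) + X.im • Complex.I := by simp
  rw [e, map_add, map_add, map_smul, map_smul, map_smul, map_smul, h1, hI]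
  simp [mul_comm]

lemma inv_sq_mul_eq_of_mul_eq {A N M Q W k l e : ℂ} (hQ : Q ≠ 0) (hW : W ≠ 0)
    (h : A * W = (k * Q ^ 2 + l * N ^ 2) * M * e) :
    (Q ^ 2)⁻¹ * A = (k + l * (N / Q) ^ 2) * (M / W) * e := by
  field_simp
  linear_combination h

/-- Complex-valued functions `S, C, D` of `u = Re z` and `s, c, d` of `v = Im z` that satisfy, at
the point `z`, the algebraic and differential equations of the Jacobi functions with parameters
`m` and `1 - m`. -/
structure JacobiSystem (m z : ℂ) (S C D s c d : ℂ → ℂ) : Prop where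
  sc : S z ^ 2 + C z ^ 2 = 1
  sd : D z ^ 2 + m * S z ^ 2 = 1
  sc' : s z ^ 2 + c z ^ 2 = 1
  sd' : d z ^ 2 + (1 - m) * s z ^ 2 = 1
  dS : HasFDerivAt S ((C z * D z) • Complex.ofRealCLM.comp Complex.reCLM) z
  dC : HasFDerivAt C ((-(S z * D z)) • Complex.ofRealCLM.comp Complex.reCLM) z
  dD : HasFDerivAt D ((-(m * S z * C z)) • Complex.ofRealCLM.comp Complex.reCLM) z
  ds : HasFDerivAt s ((c z * d z) • Complex.ofRealCLM.comp Complex.imCLM) z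
  dc : HasFDerivAt c ((-(s z * d z)) • Complex.ofRealCLM.comp Complex.imCLM) z
  dd : HasFDerivAt d ((-((1 - m) * s z * c z)) • Complex.ofRealCLM.comp Complex.imCLM) z

lemma jacobiSystem {m : ℝ} (hm0 : m ≠ 0) (hm1 : m ≠ 1) (z : ℂ) :
    JacobiSystem m z (fun w => realSn m w.re) (fun w => realCn m w.re) (fun w => realDn m w.re)
      (fun w => realSn (1 - m) w.im) (fun w => realCn (1 - m) w.im)
      (fun w => realDn (1 - m) w.im) where
  sc := by exact_mod_cast realSn_sq_add_realCn_sq hm1 z.re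
  sd := by exact_mod_cast realDn_sq_add (m := m) z.re
  sc' := by exact_mod_cast realSn_sq_add_realCn_sq (one_sub_ne_one hm0) z.im
  sd' := by exact_mod_cast realDn_sq_add (m := 1 - m) z.im
  dS := by exact_mod_cast hasFDerivAt_ofReal_re (hasDerivAt_realSn hm1 z.re)
  dC := by exact_mod_cast hasFDerivAt_ofReal_re (hasDerivAt_realCn hm1 z.re)
  dD := by exact_mod_cast hasFDerivAt_ofReal_re (hasDerivAt_realDn hm1 z.re)
  ds := by exact_mod_cast hasFDerivAt_ofReal_im (hasDerivAt_realSn (one_sub_ne_one hm0) z.im)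
  dc := by exact_mod_cast hasFDerivAt_ofReal_im (hasDerivAt_realCn (one_sub_ne_one hm0) z.im)
  dd := by exact_mod_cast hasFDerivAt_ofReal_im (hasDerivAt_realDn (one_sub_ne_one hm0) z.im)

namespace JacobiSystem

variable {m z : ℂ} {S C D s c d : ℂ → ℂ}

lemma hasDerivAt_invSn (h : JacobiSystem m z S C D s c d) (hQ : 1 - (C z * c z) ^ 2 ≠ 0)
    (hW : 1 - m * S z ^ 2 - (1 - m) * s z ^ 2 ≠ 0) :
    HasDerivAt (fun w => (S w * d w - Complex.I * (C w * D w * s w * c w)) / (1 - (C w * c w) ^ 2))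
      ((m + (-1) * ((S z * d z - Complex.I * (C z * D z * s z * c z)) / (1 - (C z * c z) ^ 2)) ^ 2)
        * ((C z * D z * d z - Complex.I * ((1 - m) * S z * s z * c z))
          / (1 - m * S z ^ 2 - (1 - m) * s z ^ 2))) z := by
  obtain ⟨h1, h2, h3, h4, hS, hC, hD, hs, hc, hd⟩ := h
  have hI := Complex.I_sq
  have h := hasFDerivAt_div ((hS.mul hd).sub ((((hC.mul hD).mul hs).mul hc).const_mul Complex.I))
    (((hC.mul hc).pow 2).const_sub 1) hQ
  refine hasDerivAt_of_hasFDerivAt_real h ?_ ?_ <;>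
  · simp only [FunLike.coe_smul, ContinuousLinearMap.coe_comp, Pi.smul_apply,
      sub_apply, add_apply, neg_apply, Complex.ofRealCLM_apply,
      Function.comp_apply, Complex.reCLM_apply, Complex.imCLM_apply, smul_eq_mul, Complex.one_re,
      Complex.one_im, Complex.I_re, Complex.I_im, Complex.ofReal_one, Complex.ofReal_zero,
      nsmul_eq_mul, Pi.mul_apply, Pi.sub_apply]
    refine inv_sq_mul_eq_of_mul_eq hQ hW ?_
    generalize Complex.I = i at *
    clear * - hI h1 h2 h3 h4
    grind

lemma hasDerivAt_invCn (h : JacobiSystem m z S C D s c d) (hQ : 1 - (S z * d z) ^ 2 ≠ 0)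
    (hW : 1 - m * S z ^ 2 - (1 - m) * s z ^ 2 ≠ 0) :
    HasDerivAt (fun w => (C w * c w + Complex.I * (S w * D w * s w * d w)) / (1 - (S w * d w) ^ 2))
      ((m + (1 - m)
          * ((C z * c z + Complex.I * (S z * D z * s z * d z)) / (1 - (S z * d z) ^ 2)) ^ 2)
        * ((S z * D z * c z + Complex.I * (C z * s z * d z))
          / (1 - m * S z ^ 2 - (1 - m) * s z ^ 2))) z := by
  obtain ⟨h1, h2, h3, h4, hS, hC, hD, hs, hc, hd⟩ := h
  have hI := Complex.I_sq
  have h := hasFDerivAt_div ((hC.mul hc).add ((((hS.mul hD).mul hs).mul hd).const_mul Complex.I))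
    (((hS.mul hd).pow 2).const_sub 1) hQ
  refine hasDerivAt_of_hasFDerivAt_real h ?_ ?_ <;>
  · simp only [FunLike.coe_smul, ContinuousLinearMap.coe_comp, Pi.smul_apply,
      sub_apply, add_apply, neg_apply, Complex.ofRealCLM_apply,
      Function.comp_apply, Complex.reCLM_apply, Complex.imCLM_apply, smul_eq_mul, Complex.one_re,
      Complex.one_im, Complex.I_re, Complex.I_im, Complex.ofReal_one, Complex.ofReal_zero,
      nsmul_eq_mul, Pi.mul_apply, Pi.add_apply]
    refine inv_sq_mul_eq_of_mul_eq hQ hW ?_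
    generalize Complex.I = i at *
    clear * - hI h1 h2 h3 h4
    grind

lemma hasDerivAt_snDivCn (h : JacobiSystem m z S C D s c d) (hQ : 1 - (S z * d z) ^ 2 ≠ 0)
    (hW : 1 - m * S z ^ 2 - (1 - m) * s z ^ 2 ≠ 0) :
    HasDerivAt (fun w => (S w * C w * c w * d w + Complex.I * (D w * s w)) / (1 - (S w * d w) ^ 2))
      ((1 + (1 - m)
          * ((S z * C z * c z * d z + Complex.I * (D z * s z)) / (1 - (S z * d z) ^ 2)) ^ 2)
        * ((D z * c z * d z + Complex.I * (m * S z * C z * s z))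
          / (1 - m * S z ^ 2 - (1 - m) * s z ^ 2))) z := by
  obtain ⟨h1, h2, h3, h4, hS, hC, hD, hs, hc, hd⟩ := h
  have hI := Complex.I_sq
  have h := hasFDerivAt_div ((((hS.mul hC).mul hc).mul hd).add ((hD.mul hs).const_mul Complex.I))
    (((hS.mul hd).pow 2).const_sub 1) hQ
  refine hasDerivAt_of_hasFDerivAt_real h ?_ ?_ <;>
  · simp only [FunLike.coe_smul, ContinuousLinearMap.coe_comp, Pi.smul_apply,
      sub_apply, add_apply, neg_apply, Complex.ofRealCLM_apply,
      Function.comp_apply, Complex.reCLM_apply, Complex.imCLM_apply, smul_eq_mul, Complex.one_re,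
      Complex.one_im, Complex.I_re, Complex.I_im, Complex.ofReal_one, Complex.ofReal_zero,
      nsmul_eq_mul, Pi.mul_apply, Pi.add_apply]
    refine inv_sq_mul_eq_of_mul_eq hQ hW ?_
    generalize Complex.I = i at *
    clear * - hI h1 h2 h3 h4
    grind

end JacobiSystem

/-! ### Derivatives and algebraic relations of the quotients -/

lemma hasDerivAt_invSn {m : ℝ} (hm0 : m ≠ 0) (hm1 : m ≠ 1) {z : ℂ} (hz : z ∈ regularDomain m) :
    HasDerivAt (invSn m) ((m + (-1) * invSn m z ^ 2) * cnDivDn m z) z := by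
  have hQ : (1 - (realCn m z.re * realCn (1 - m) z.im : ℂ) ^ 2) ≠ 0 := by
    exact_mod_cast (one_sub_cn_sq_pos hm0 hm1 hz.1).ne'
  have hW : (1 - m * realSn m z.re ^ 2 - (1 - m) * realSn (1 - m) z.im ^ 2 : ℂ) ≠ 0 := by
    exact_mod_cast (conformalFactor_pos hm0 hm1 hz).ne'
  refine ((jacobiSystem hm0 hm1 z).hasDerivAt_invSn hQ hW).congr_deriv ?_
  simp [invSn, cnDivDn, conformalFactor]

lemma hasDerivAt_invCn {m : ℝ} (hm0 : m ≠ 0) (hm1 : m ≠ 1) {z : ℂ} (hz : z ∈ regularDomain m) :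
    HasDerivAt (invCn m) ((m + (1 - m) * invCn m z ^ 2) * snDivDn m z) z := by
  have hQ : (1 - (realSn m z.re * realDn (1 - m) z.im : ℂ) ^ 2) ≠ 0 := by
    exact_mod_cast (one_sub_sn_sq_pos hm0 hm1 hz.1).ne'
  have hW : (1 - m * realSn m z.re ^ 2 - (1 - m) * realSn (1 - m) z.im ^ 2 : ℂ) ≠ 0 := by
    exact_mod_cast (conformalFactor_pos hm0 hm1 hz).ne'
  refine ((jacobiSystem hm0 hm1 z).hasDerivAt_invCn hQ hW).congr_deriv ?_
  simp [invCn, snDivDn, conformalFactor]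

lemma hasDerivAt_snDivCn {m : ℝ} (hm0 : m ≠ 0) (hm1 : m ≠ 1) {z : ℂ} (hz : z ∈ regularDomain m) :
    HasDerivAt (snDivCn m) ((1 + (1 - m) * snDivCn m z ^ 2) * invDn m z) z := by
  have hQ : (1 - (realSn m z.re * realDn (1 - m) z.im : ℂ) ^ 2) ≠ 0 := by
    exact_mod_cast (one_sub_sn_sq_pos hm0 hm1 hz.1).ne'
  have hW : (1 - m * realSn m z.re ^ 2 - (1 - m) * realSn (1 - m) z.im ^ 2 : ℂ) ≠ 0 := by
    exact_mod_cast (conformalFactor_pos hm0 hm1 hz).ne'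
  refine ((jacobiSystem hm0 hm1 z).hasDerivAt_snDivCn hQ hW).congr_deriv ?_
  simp [snDivCn, invDn, conformalFactor]

lemma mul_sq_eq_of_mul_eq {N M Q W k l e : ℂ} (hQ : Q ≠ 0) (hW : W ≠ 0)
    (h : (k * Q ^ 2 + l * N ^ 2) * M ^ 2 = e * (Q ^ 2 * W ^ 2)) :
    (k + l * (N / Q) ^ 2) * (M / W) ^ 2 = e := by
  field_simp
  linear_combination h

/-- This is `(m - 1 / sn²) (sn / dn)² = -1`. -/
lemma invSn_relation {m : ℝ} (hm0 : m ≠ 0) (hm1 : m ≠ 1) {z : ℂ} (hz : z ∈ regularDomain m) :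
    (m + (-1) * invSn m z ^ 2) * snDivDn m z ^ 2 = -1 := by
  have hQ : (1 - (realCn m z.re * realCn (1 - m) z.im : ℂ) ^ 2) ≠ 0 := by
    exact_mod_cast (one_sub_cn_sq_pos hm0 hm1 hz.1).ne'
  have hW : (1 - m * realSn m z.re ^ 2 - (1 - m) * realSn (1 - m) z.im ^ 2 : ℂ) ≠ 0 := by
    exact_mod_cast (conformalFactor_pos hm0 hm1 hz).ne'
  obtain ⟨h1, h2, h3, h4, -⟩ := jacobiSystem hm0 hm1 z
  have hI := Complex.I_sq
  simp only [invSn, snDivDn, conformalFactor, Complex.ofReal_mul, Complex.ofReal_sub,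
    Complex.ofReal_pow, Complex.ofReal_one]
  generalize Complex.I = i at *
  refine mul_sq_eq_of_mul_eq hQ hW ?_
  clear hz hQ hW
  grind

/-- This is `(m + (1 - m) / cn²) (cn / dn)² = 1`. -/
lemma invCn_relation {m : ℝ} (hm0 : m ≠ 0) (hm1 : m ≠ 1) {z : ℂ} (hz : z ∈ regularDomain m) :
    (m + (1 - m) * invCn m z ^ 2) * cnDivDn m z ^ 2 = 1 := by
  have hQ : (1 - (realSn m z.re * realDn (1 - m) z.im : ℂ) ^ 2) ≠ 0 := by
    exact_mod_cast (one_sub_sn_sq_pos hm0 hm1 hz.1).ne'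
  have hW : (1 - m * realSn m z.re ^ 2 - (1 - m) * realSn (1 - m) z.im ^ 2 : ℂ) ≠ 0 := by
    exact_mod_cast (conformalFactor_pos hm0 hm1 hz).ne'
  obtain ⟨h1, h2, h3, h4, -⟩ := jacobiSystem hm0 hm1 z
  have hI := Complex.I_sq
  simp only [invCn, cnDivDn, conformalFactor, Complex.ofReal_mul, Complex.ofReal_sub,
    Complex.ofReal_pow, Complex.ofReal_one]
  generalize Complex.I = i at *
  refine mul_sq_eq_of_mul_eq hQ hW ?_
  clear hz hQ hW
  grind

/-- This is `(1 + (1 - m) (sn / cn)²) (cn / dn)² = 1`. -/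
lemma snDivCn_relation {m : ℝ} (hm0 : m ≠ 0) (hm1 : m ≠ 1) {z : ℂ} (hz : z ∈ regularDomain m) :
    (1 + (1 - m) * snDivCn m z ^ 2) * cnDivDn m z ^ 2 = 1 := by
  have hQ : (1 - (realSn m z.re * realDn (1 - m) z.im : ℂ) ^ 2) ≠ 0 := by
    exact_mod_cast (one_sub_sn_sq_pos hm0 hm1 hz.1).ne'
  have hW : (1 - m * realSn m z.re ^ 2 - (1 - m) * realSn (1 - m) z.im ^ 2 : ℂ) ≠ 0 := by
    exact_mod_cast (conformalFactor_pos hm0 hm1 hz).ne'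
  obtain ⟨h1, h2, h3, h4, -⟩ := jacobiSystem hm0 hm1 z
  have hI := Complex.I_sq
  simp only [snDivCn, cnDivDn, conformalFactor, Complex.ofReal_mul, Complex.ofReal_sub,
    Complex.ofReal_pow, Complex.ofReal_one]
  generalize Complex.I = i at *
  refine mul_sq_eq_of_mul_eq hQ hW ?_
  clear hz hQ hW
  grind

/-- Off the poles, `invSn`, `invCn`, `snDivCn` are nonzero and agree with the quotients of the
Jacobi functions after which they are named. -/
lemma quotients_eq {m : ℝ} (hm0 : m ≠ 0) (hm1 : m ≠ 1) {z : ℂ} (hz : z ∈ paramDomain m)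
    (hden : jacobiDen m z ≠ 0) :
    (jacobiSn m z = (invSn m z)⁻¹ ∧ invSn m z ≠ 0) ∧
      (jacobiCn m z = (invCn m z)⁻¹ ∧ invCn m z ≠ 0) ∧
      (jacobiSn m z / jacobiCn m z = snDivCn m z ∧ snDivCn m z ≠ 0) := by
  have hQ₁ : (1 - (realCn m z.re * realCn (1 - m) z.im : ℂ) ^ 2) ≠ 0 := by
    exact_mod_cast (one_sub_cn_sq_pos hm0 hm1 hz).ne'
  have hQ₂ : (1 - (realSn m z.re * realDn (1 - m) z.im : ℂ) ^ 2) ≠ 0 := by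
    exact_mod_cast (one_sub_sn_sq_pos hm0 hm1 hz).ne'
  have hden' :
      (realCn (1 - m) z.im ^ 2 + m * realSn m z.re ^ 2 * realSn (1 - m) z.im ^ 2 : ℂ) ≠ 0 := by
    exact_mod_cast hden
  obtain ⟨h1, h2, h3, h4, -⟩ := jacobiSystem hm0 hm1 z
  have hI := Complex.I_sq
  have e1 : jacobiSn m z * invSn m z = 1 := by
    simp only [invSn, jacobiSn, jacobiDen, Complex.ofReal_mul, Complex.ofReal_add,
      Complex.ofReal_pow]
    rw [div_mul_div_comm, div_eq_iff (mul_ne_zero hden' hQ₁)]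
    generalize Complex.I = i at *
    clear hz hQ₁ hQ₂ hden hden'
    grind
  have e2 : jacobiCn m z * invCn m z = 1 := by
    simp only [invCn, jacobiCn, jacobiDen, Complex.ofReal_mul, Complex.ofReal_add,
      Complex.ofReal_pow]
    rw [div_mul_div_comm, div_eq_iff (mul_ne_zero hden' hQ₂)]
    generalize Complex.I = i at *
    clear hz hQ₁ hQ₂ hden hden'
    grind
  have e3 : jacobiSn m z = snDivCn m z * jacobiCn m z := by
    simp only [snDivCn, jacobiSn, jacobiCn, jacobiDen, Complex.ofReal_mul, Complex.ofReal_add,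
      Complex.ofReal_pow]
    rw [div_mul_div_comm, mul_comm (1 - _ : ℂ), ← div_div]
    rw [div_right_comm, eq_comm]
    congr 1
    rw [div_eq_iff hQ₂]
    generalize Complex.I = i at *
    clear hz hQ₁ hQ₂ hden hden' e1 e2
    grind
  have n1 := right_ne_zero_of_mul_eq_one e1
  have n2 := left_ne_zero_of_mul_eq_one e2
  refine ⟨⟨eq_inv_of_mul_eq_one_left e1, n1⟩,
    ⟨eq_inv_of_mul_eq_one_left e2, right_ne_zero_of_mul_eq_one e2⟩, ?_, ?_⟩
  · rw [e3, mul_div_cancel_right₀ _ n2]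
  · intro h0
    rw [h0, zero_mul] at e3
    exact left_ne_zero_of_mul_eq_one e1 e3

/-! ### Density of the complements of exceptional curves -/

/-- `sn²` is nowhere locally constant: at a critical point its second derivative is nonzero. -/
lemma frequently_realSn_sq_ne {m : ℝ} (hm : m ≠ 1) (e u₀ : ℝ) :
    ∃ᶠ u in nhds u₀, realSn m u ^ 2 ≠ e := by
  intro hev
  simp only [not_not] at hev
  have h1 : ∀ᶠ u in nhds u₀, realSn m u * (realCn m u * realDn m u) = 0 := by
    filter_upwards [hev.eventually_nhds] with u hu
    have hd : HasDerivAt (fun u => realSn m u ^ 2) 0 u :=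
      (hasDerivAt_const u e).congr_of_eventuallyEq hu
    have := hd.unique ((hasDerivAt_realSn hm u).pow 2)
    push_cast at this
    linarith
  have h2 := ((hasDerivAt_const u₀ (0 : ℝ)).congr_of_eventuallyEq h1).unique
    ((hasDerivAt_realSn hm u₀).mul ((hasDerivAt_realCn hm u₀).mul (hasDerivAt_realDn hm u₀)))
  have h3 := h1.self_of_nhds
  have h4 := realSn_sq_add_realCn_sq hm u₀
  have h5 := realDn_sq_add (m := m) u₀
  generalize realSn m u₀ = S at *
  generalize realCn m u₀ = C at *
  generalize realDn m u₀ = D at *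
  clear hev h1
  grind

lemma frequently_realDn_sq_ne {m : ℝ} (hm0 : m ≠ 0) (hm1 : m ≠ 1) (e u₀ : ℝ) :
    ∃ᶠ u in nhds u₀, realDn m u ^ 2 ≠ e := by
  refine (frequently_realSn_sq_ne hm1 ((1 - e) / m) u₀).mono fun u hu h => hu ?_
  rw [eq_div_iff hm0]
  linarith [realDn_sq_add (m := m) u]

lemma frequently_re_im {P Q : ℝ → Prop} {z : ℂ} (hP : ∃ᶠ u in nhds z.re, P u)
    (hQ : ∃ᶠ v in nhds z.im, Q v) : ∃ᶠ w in nhds z, P w.re ∧ Q w.im := by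
  have hc : Filter.Tendsto (fun x : ℝ × ℝ => (⟨x.1, x.2⟩ : ℂ)) (nhds z.re ×ˢ nhds z.im)
      (nhds z) := by
    have : Continuous fun x : ℝ × ℝ => (⟨x.1, x.2⟩ : ℂ) :=
      Complex.equivRealProdCLM.symm.continuous
    rw [← nhds_prod_eq]
    exact this.tendsto (z.re, z.im)
  refine hc.frequently (p := fun w => P w.re ∧ Q w.im) ?_
  intro h
  obtain ⟨A, hA, B, hB, hAB⟩ := Filter.mem_prod_iff.1 h
  obtain ⟨u, hu, huA⟩ := (hP.and_eventually hA).exists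
  obtain ⟨v, hv, hvB⟩ := (hQ.and_eventually hB).exists
  exact hAB (Set.mk_mem_prod huA hvB) ⟨hu, hv⟩

/-- The poles have empty interior. -/
lemma frequently_jacobiDen_ne_zero {m : ℝ} (hm0 : m ≠ 0) (hm1 : m ≠ 1) (z : ℂ) :
    ∃ᶠ w in nhds z, jacobiDen m w ≠ 0 := by
  have hQ : ∃ᶠ v in nhds z.im, v = z.im := fun h => h.self_of_nhds rfl
  refine (frequently_re_im (frequently_realDn_sq_ne hm0 hm1 ((realSn (1 - m) z.im ^ 2)⁻¹) z.re)
    hQ).mono ?_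
  rintro w ⟨hw, hv⟩ h0
  rw [jacobiDen_eq hm0, hv, mul_pow] at h0
  exact hw (eq_inv_of_mul_eq_one_left (by linarith))

/-! ### Branches of the inverse hyperbolic tangent -/

/-- The relation `tanh h = t` in exponential form. The value `t = 0` is excluded because
`Complex.tanh` also takes the value `0` at its poles. -/
lemma exp_two_mul_of_tanh_eq {h t : ℂ} (ht : t ≠ 0) (h0 : Complex.tanh h = t) :
    Complex.exp (2 * h) * (1 - t) = 1 + t := by
  have hc : Complex.cosh h ≠ 0 := by
    intro hc
    rw [Complex.tanh_eq_sinh_div_cosh, hc, div_zero] at h0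
    exact ht h0.symm
  have hs : Complex.sinh h = t * Complex.cosh h := by
    rw [← h0, Complex.tanh_eq_sinh_div_cosh, div_mul_cancel₀ _ hc]
  have e1 : Complex.exp h = (1 + t) * Complex.cosh h := by
    rw [← Complex.cosh_add_sinh, hs]; ring
  have e2 : Complex.exp (-h) = (1 - t) * Complex.cosh h := by
    rw [← Complex.cosh_sub_sinh, hs]; ring
  have e3 : Complex.exp (2 * h) * Complex.exp (-h) = Complex.exp h := by
    rw [← Complex.exp_add]; congr 1; ring
  rw [e1, e2, ← mul_assoc] at e3
  exact mul_right_cancel₀ hc e3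

lemma tanh_eq_of_exp_two_mul {h t : ℂ} (h0 : Complex.exp (2 * h) * (1 - t) = 1 + t) :
    Complex.tanh h = t := by
  have e3 : Complex.exp (2 * h) * Complex.exp (-h) = Complex.exp h := by
    rw [← Complex.exp_add]; congr 1; ring
  have e4 : Complex.exp (-h) ≠ 0 := Complex.exp_ne_zero _
  have e5 : Complex.exp (2 * h) + 1 ≠ 0 := fun h5 => by
    have : Complex.exp (2 * h) = -1 := by linear_combination h5
    rw [this] at h0
    have : (2 : ℂ) = 0 := by linear_combination -h0
    norm_num at this
  rw [Complex.tanh_eq_sinh_div_cosh, Complex.sinh, Complex.cosh,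
    div_div_div_cancel_right₀ two_ne_zero, ← e3, div_eq_iff (by
      rw [show Complex.exp (2 * h) * Complex.exp (-h) + Complex.exp (-h)
        = (Complex.exp (2 * h) + 1) * Complex.exp (-h) by ring]
      exact mul_ne_zero e5 e4)]
  linear_combination Complex.exp (-h) * h0

lemma hasDerivAt_of_exp_eq {h G : ℂ → ℂ} {G' z : ℂ} (hc : ContinuousAt h z)
    (he : ∀ᶠ w in nhds z, Complex.exp (h w) = G w) (hG : HasDerivAt G G' z) :
    HasDerivAt h (G' / G z) z := by
  have hz : G z ≠ 0 := by rw [← he.self_of_nhds]; exact Complex.exp_ne_zero _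
  have hlog : HasDerivAt (fun w => h z + Complex.log (G w / G z)) (G' / G z) z := by
    have := ((hG.div_const (G z)).clog (by simp [hz])).const_add (h z)
    simpa [hz] using this
  refine hlog.congr_of_eventuallyEq ?_
  -- near `z` the difference `h w - h z` stays in the strip where `log` inverts `exp`
  have him : ∀ᶠ w in nhds z, |(h w - h z).im| < Real.pi := by
    have : ContinuousAt (fun w => |(h w - h z).im|) z := by fun_prop
    refine this.eventually_lt_const ?_
    simpa using Real.pi_pos
  filter_upwards [him, he] with w hw hew
  have h2 := abs_lt.1 hw
  rw [← hew, ← he.self_of_nhds, ← Complex.exp_sub, Complex.log_exp h2.1 h2.2.le]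
  ring

/-- A continuous branch of `artanh t`, for a holomorphic function `t ≠ ±1`, is holomorphic; the
equation `tanh h = t` may fail on a set with empty interior. -/
lemma hasDerivAt_of_tanh_eq {V : Set ℂ} (hV : IsOpen V) {h t : ℂ → ℂ} (hc : ContinuousOn h V)
    (ht : ∀ z ∈ V, DifferentiableAt ℂ t z) (h1 : ∀ z ∈ V, 1 - t z ^ 2 ≠ 0)
    (hfr : ∀ z ∈ V, ∃ᶠ w in nhds z, t w ≠ 0 ∧ Complex.tanh (h w) = t w)
    {z t' : ℂ} (hz : z ∈ V) (ht' : HasDerivAt t t' z) :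
    HasDerivAt h (t' / (1 - t z ^ 2)) z := by
  have hcont : ∀ w ∈ V, ContinuousAt h w := fun w hw => hc.continuousAt (hV.mem_nhds hw)
  -- both sides of the exponential form of the equation are continuous, so it holds everywhere
  have hexp : ∀ w ∈ V, Complex.exp (2 * h w) * (1 - t w) = 1 + t w := by
    intro w hw
    by_contra hne
    have c1 := hcont w hw
    have c2 := (ht w hw).continuousAt
    have c3 : ContinuousAt (fun x => Complex.exp (2 * h x) * (1 - t x) - (1 + t x)) w := by
      fun_prop
    obtain ⟨x, ⟨hx0, hx1⟩, hx⟩ :=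
      ((hfr w hw).and_eventually (c3.eventually_ne (sub_ne_zero.2 hne))).exists
    exact sub_ne_zero.1 hx (exp_two_mul_of_tanh_eq hx0 hx1)
  have hn : ∀ w ∈ V, 1 - t w ≠ 0 := fun w hw h0 => h1 w hw (by linear_combination (1 + t w) * h0)
  have hp : ∀ w ∈ V, 1 + t w ≠ 0 := fun w hw h0 => h1 w hw (by linear_combination (1 - t w) * h0)
  have hG : HasDerivAt (fun w => (1 + t w) / (1 - t w))
      ((t' * (1 - t z) - (1 + t z) * (-t')) / (1 - t z) ^ 2) z :=
    (ht'.const_add 1).div (ht'.const_sub 1) (hn z hz)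
  have h2 := hasDerivAt_of_exp_eq (h := fun w => 2 * h w) ((hcont z hz).const_mul 2) ?_ hG
  · have h3 := h2.const_mul (1 / 2 : ℂ)
    have e : (fun w => 1 / 2 * (2 * h w)) = h := by funext w; ring
    rw [e] at h3
    refine h3.congr_deriv ?_
    have e1 := hn z hz
    have e2 := hp z hz
    have e3 := h1 z hz
    have e4 : 1 - t z ^ 2 = (1 - t z) * (1 + t z) := by ring
    rw [e4]
    field_simp
    ring
  · filter_upwards [hV.mem_nhds hz] with w hw
    rw [eq_div_iff (hn w hw), hexp w hw]

/-- On a simply connected domain, `artanh t` has a continuous branch if `t ≠ ±1`. -/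
lemma exists_continuousOn_tanh_eq {V : Set ℂ} (hV : IsOpen V) (hs : SimplyConnectedSpace V)
    {t : ℂ → ℂ} (ht : ContinuousOn t V) (h1 : ∀ z ∈ V, 1 - t z ^ 2 ≠ 0) :
    ∃ h : ℂ → ℂ, ContinuousOn h V ∧ ∀ z ∈ V, Complex.tanh (h z) = t z := by
  have hn : ∀ w ∈ V, 1 - t w ≠ 0 := fun w hw h0 => h1 w hw (by linear_combination (1 + t w) * h0)
  have hp : ∀ w ∈ V, 1 + t w ≠ 0 := fun w hw h0 => h1 w hw (by linear_combination (1 - t w) * h0)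
  obtain ⟨g, hg, he⟩ := Complex.exists_continuousOn_eqOn_exp_comp (U := V) hs hV
    (g := fun w => (1 + t w) / (1 - t w))
    ((continuousOn_const.add ht).div (continuousOn_const.sub ht) hn) (by
      rintro ⟨w, hw, h0⟩
      exact div_ne_zero (hp w hw) (hn w hw) h0)
  refine ⟨fun w => g w / 2, hg.div_const 2, fun w hw => tanh_eq_of_exp_two_mul ?_⟩
  have := he hw
  simp only [Function.comp] at this
  rw [mul_div_cancel₀ _ (two_ne_zero), this, div_mul_cancel₀ _ (hn w hw)]

/-! ### First and second derivatives of parametrized surfaces -/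

/-- The linear map with partial derivatives `P` and `Q`. -/
def frame (P Q : Fin 3 → ℝ) : ℂ →L[ℝ] (Fin 3 → ℝ) :=
  Complex.reCLM.smulRight P + Complex.imCLM.smulRight Q

lemma frame_apply (P Q : Fin 3 → ℝ) (X : ℂ) : frame P Q X = X.re • P + X.im • Q := rfl

lemma eq_frame (L : ℂ →L[ℝ] (Fin 3 → ℝ)) : L = frame (L 1) (L Complex.I) := by
  ext1 X
  have e : X = X.re • (1 : ℂ) + X.im • Complex.I := by simp
  rw [frame_apply, ← map_smul, ← map_smul, ← map_add, ← e]

lemma frame_injective {P Q : Fin 3 → ℝ} (h : P 0 * Q 1 - P 1 * Q 0 ≠ 0) :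
    Function.Injective (frame P Q) := by
  refine (injective_iff_map_eq_zero _).2 fun X hX => ?_
  have h0 := congrFun hX 0
  have h1 := congrFun hX 1
  simp only [frame_apply, Pi.add_apply, Pi.smul_apply, smul_eq_mul, Pi.zero_apply] at h0 h1
  have e1 : X.re * (P 0 * Q 1 - P 1 * Q 0) = 0 := by linear_combination Q 1 * h0 - Q 0 * h1
  have e2 : X.im * (P 0 * Q 1 - P 1 * Q 0) = 0 := by linear_combination P 0 * h1 - P 1 * h0
  exact Complex.ext ((mul_eq_zero.1 e1).resolve_right h) ((mul_eq_zero.1 e2).resolve_right h)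

lemma det3_eq (X Y Z : Fin 3 → ℝ) : det3 X Y Z = X 0 * Y 1 * Z 2 - X 0 * Y 2 * Z 1
    - X 1 * Y 0 * Z 2 + X 1 * Y 2 * Z 0 + X 2 * Y 0 * Z 1 - X 2 * Y 1 * Z 0 := by
  simp [det3, Matrix.det_fin_three]

section Surface

variable {x : ℂ → Fin 3 → ℝ} {z : ℂ}

lemma differentiableAt_fderiv_apply (hx : ContDiffAt ℝ ∞ x z) (X : ℂ) :
    DifferentiableAt ℝ (fun w => fderiv ℝ x w X) z := by
  have : ContDiffAt ℝ 1 (fderiv ℝ x) z := hx.fderiv_right (by norm_cast)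
  exact (this.differentiableAt one_ne_zero).clm_apply (differentiableAt_const X)

lemma differentiableAt_dU (hx : ContDiffAt ℝ ∞ x z) : DifferentiableAt ℝ (dU x) z :=
  differentiableAt_fderiv_apply hx 1

lemma differentiableAt_dV (hx : ContDiffAt ℝ ∞ x z) : DifferentiableAt ℝ (dV x) z :=
  differentiableAt_fderiv_apply hx Complex.I

lemma dV_dU_eq_dU_dV (hx : ContDiffAt ℝ ∞ x z) : dV (dU x) z = dU (dV x) z := by
  have h1 : ContDiffAt ℝ 1 (fderiv ℝ x) z := hx.fderiv_right (by norm_cast)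
  have h2 := h1.differentiableAt one_ne_zero
  have h3 : IsSymmSndFDerivAt ℝ x z := hx.isSymmSndFDerivAt (by simp; norm_cast)
  have e : ∀ X Y : ℂ, fderiv ℝ (fun w => fderiv ℝ x w X) z Y = fderiv ℝ (fderiv ℝ x) z Y X := by
    intro X Y
    rw [fderiv_clm_apply h2 (differentiableAt_const X)]
    simp
  change fderiv ℝ (fun w => fderiv ℝ x w 1) z Complex.I
    = fderiv ℝ (fun w => fderiv ℝ x w Complex.I) z 1
  rw [e, e]
  exact h3 _ _

/-- Differentiating the orthogonality relation `n · X = 0`. -/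
lemma dotProduct_fderiv_add {n X : ℂ → Fin 3 → ℝ} {N : ℂ →L[ℝ] (Fin 3 → ℝ)}
    (hn : HasFDerivAt n N z) (hX : DifferentiableAt ℝ X z)
    (h : ∀ᶠ w in nhds z, n w ⬝ᵥ X w = 0) (Y : ℂ) :
    N Y ⬝ᵥ X z + n z ⬝ᵥ fderiv ℝ X z Y = 0 := by
  have hn' := hasFDerivAt_pi'.1 hn
  have hX' := hasFDerivAt_pi'.1 hX.hasFDerivAt
  have h1 : HasFDerivAt (fun w => n w ⬝ᵥ X w) (0 : ℂ →L[ℝ] ℝ) z :=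
    (hasFDerivAt_const (0 : ℝ) z).congr_of_eventuallyEq h
  have h2 := (((hn' 0).fun_mul (hX' 0)).fun_add ((hn' 1).fun_mul (hX' 1))).fun_add
    ((hn' 2).fun_mul (hX' 2))
  have e : (fun w => n w 0 * X w 0 + n w 1 * X w 1 + n w 2 * X w 2) = fun w => n w ⬝ᵥ X w := by
    funext w; simp [dotProduct, Fin.sum_univ_three]
  rw [e] at h2
  have h3 := DFunLike.congr_fun (h1.unique h2) Y
  simp at h3
  simp only [dotProduct, Fin.sum_univ_three]
  linear_combination -h3

/-- Real parts of holomorphic functions are harmonic. -/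
lemma dU_dU_add_dV_dV_re {V : Set ℂ} (hV : IsOpen V) {F : Fin 3 → ℂ → ℂ}
    (hF : ∀ j, DifferentiableOn ℂ (F j) V) (hz : z ∈ V) :
    dU (dU fun w j => (F j w).re) z + dV (dV fun w j => (F j w).re) z = 0 := by
  have hre : ∀ (G : Fin 3 → ℂ → ℂ) (w : ℂ), (∀ j, DifferentiableAt ℂ (G j) w) → ∀ X : ℂ,
      fderiv ℝ (fun w j => (G j w).re) w X = fun j => (deriv (G j) w * X).re := by
    intro G w hG X
    have : HasFDerivAt (fun w j => (G j w).re) (ContinuousLinearMap.pi fun j =>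
        Complex.reCLM.comp
          ((ContinuousLinearMap.toSpanSingleton ℂ (deriv (G j) w)).restrictScalars ℝ)) w :=
      hasFDerivAt_pi.2 fun j => Complex.reCLM.hasFDerivAt.comp w
        ((hG j).hasDerivAt.hasFDerivAt.restrictScalars ℝ)
    rw [this.fderiv]
    ext j
    simp [mul_comm]
  have hd : ∀ w ∈ V, ∀ j, DifferentiableAt ℂ (F j) w := fun w hw j =>
    (hF j).differentiableAt (hV.mem_nhds hw)
  have hd' : ∀ j, DifferentiableAt ℂ (deriv (F j)) z := fun j =>
    ((hF j).deriv hV).differentiableAt (hV.mem_nhds hz)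
  have e1 : dU (fun w j => (F j w).re) =ᶠ[nhds z] fun w j => (deriv (F j) w).re := by
    filter_upwards [hV.mem_nhds hz] with w hw
    simp only [dU, hre F w (hd w hw), mul_one]
  have e2 : dV (fun w j => (F j w).re) =ᶠ[nhds z] fun w j => (deriv (F j) w * Complex.I).re := by
    filter_upwards [hV.mem_nhds hz] with w hw
    simp only [dV, hre F w (hd w hw)]
  rw [dU, dV, e1.fderiv_eq, e2.fderiv_eq, hre _ z hd',
    hre (fun j w => deriv (F j) w * Complex.I) z fun j => (hd' j).mul_const _]
  ext j
  simp

lemma mink_frame {P Q : Fin 3 → ℝ} {g : ℝ} (hP : mink P P = g) (hQ : mink Q Q = g)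
    (hPQ : mink P Q = 0) (X : ℂ) :
    mink (frame P Q X) (frame P Q X) = (X.re ^ 2 + X.im ^ 2) * g := by
  simp only [mink, frame_apply, Pi.add_apply, Pi.smul_apply, smul_eq_mul] at *
  linear_combination X.re ^ 2 * hP + X.im ^ 2 * hQ + 2 * X.re * X.im * hPQ

/-- A harmonic surface with isothermal parameters is minimal (here: maximal). -/
lemma meanCurvature_eq_zero (hE : mink (dU x z) (dU x z) = mink (dV x z) (dV x z))
    (hF : mink (dU x z) (dV x z) = 0) (hΔ : dU (dU x) z + dV (dV x) z = 0) :
    meanCurvature x z = 0 := by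
  have h : dV (dV x) z = -dU (dU x) z := (neg_eq_of_add_eq_zero_right hΔ).symm
  have hdet : ∀ X Y Z : Fin 3 → ℝ, det3 (-X) Y Z = -det3 X Y Z := by
    intro X Y Z
    simp only [det3_eq, Pi.neg_apply]
    ring
  unfold meanCurvature
  simp only [h, hdet, hE, hF]
  ring

lemma det3_eq_zero {n X Y Z : Fin 3 → ℝ} (hn : n 2 ≠ 0) (hX : n ⬝ᵥ X = 0) (hY : n ⬝ᵥ Y = 0)
    (hZ : n ⬝ᵥ Z = 0) : det3 X Y Z = 0 := by
  simp only [dotProduct, Fin.sum_univ_three] at hX hY hZ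
  have : n 2 * det3 X Y Z = 0 := by
    rw [det3_eq]
    linear_combination (Y 0 * Z 1 - Y 1 * Z 0) * hX - (X 0 * Z 1 - X 1 * Z 0) * hY
      + (X 0 * Y 1 - X 1 * Y 0) * hZ
  exact (mul_eq_zero.1 this).resolve_left hn

end Surface

lemma det_eq (S : ℂ →L[ℝ] ℂ) :
    S.det = (S 1).re * (S Complex.I).im - (S Complex.I).re * (S 1).im := by
  change LinearMap.det (S : ℂ →ₗ[ℝ] ℂ) = _
  rw [← LinearMap.det_toMatrix Complex.basisOneI, Matrix.det_fin_two]
  simp [LinearMap.toMatrix_apply]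

/-! ### The parametrized hyperboloid -/

/-- The `u`-derivative of the parametrization of the hyperboloid. -/
def paramU (a b c m : ℝ) (z : ℂ) : Fin 3 → ℝ :=
  (1 / (realDn m z.re ^ 2 * realSn (1 - m) z.im)) •
    ![-(a * ((1 - m) * realSn m z.re * realCn (1 - m) z.im)),
      b * (realCn m z.re * realDn (1 - m) z.im), c * (m * realSn m z.re * realCn m z.re)]

/-- The `v`-derivative of the parametrization of the hyperboloid. -/
def paramV (a b c m : ℝ) (z : ℂ) : Fin 3 → ℝ :=
  (1 / (realDn m z.re * realSn (1 - m) z.im ^ 2)) •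
    ![-(a * (realCn m z.re * realDn (1 - m) z.im)),
      -(b * (realSn m z.re * realCn (1 - m) z.im)),
      -(c * (realCn (1 - m) z.im * realDn (1 - m) z.im))]

/-- A (Euclidean) normal vector field of the hyperboloid. -/
def paramNormal (a b c m : ℝ) (z : ℂ) : Fin 3 → ℝ :=
  ![realCn m z.re * realCn (1 - m) z.im / a, realSn m z.re * realDn (1 - m) z.im / b, -(1 / c)]

/-- The `u`-derivative of the normal vector field. -/
def normalU (a b m : ℝ) (z : ℂ) : Fin 3 → ℝ :=
  ![-(realSn m z.re * realDn m z.re * realCn (1 - m) z.im) / a,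
    realCn m z.re * realDn m z.re * realDn (1 - m) z.im / b, 0]

/-- The `v`-derivative of the normal vector field. -/
def normalV (a b m : ℝ) (z : ℂ) : Fin 3 → ℝ :=
  ![-(realCn m z.re * (realSn (1 - m) z.im * realDn (1 - m) z.im)) / a,
    -(realSn m z.re * ((1 - m) * realSn (1 - m) z.im * realCn (1 - m) z.im)) / b, 0]

lemma hasFDerivAt_re {g : ℝ → ℝ} {g' : ℝ} {z : ℂ} (h : HasDerivAt g g' z.re) :
    HasFDerivAt (fun w : ℂ => g w.re) (g' • Complex.reCLM) z := by
  refine (h.hasFDerivAt.comp z Complex.reCLM.hasFDerivAt).congr_fderiv ?_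
  ext X
  simp [mul_comm]

lemma hasFDerivAt_im {g : ℝ → ℝ} {g' : ℝ} {z : ℂ} (h : HasDerivAt g g' z.im) :
    HasFDerivAt (fun w : ℂ => g w.im) (g' • Complex.imCLM) z := by
  refine (h.hasFDerivAt.comp z Complex.imCLM.hasFDerivAt).congr_fderiv ?_
  ext X
  simp [mul_comm]

lemma isOpen_paramDomain {m : ℝ} (hm0 : m ≠ 0) (hm1 : m ≠ 1) : IsOpen (paramDomain m) := by
  have h1 := (contDiff_realDn hm1).continuous
  have h2 := (contDiff_realSn (one_sub_ne_one hm0)).continuous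
  exact isOpen_ne_fun (by fun_prop) (by fun_prop)

lemma contDiffAt_hyperboloidParam {m : ℝ} (hm0 : m ≠ 0) (hm1 : m ≠ 1) (a b c : ℝ) {z : ℂ}
    (hz : z ∈ paramDomain m) : ContDiffAt ℝ ∞ (hyperboloidParam a b c m) z := by
  have hre : ContDiff ℝ ∞ Complex.re := Complex.reCLM.contDiff
  have him : ContDiff ℝ ∞ Complex.im := Complex.imCLM.contDiff
  have dS := ((contDiff_realSn hm1).comp hre).contDiffAt (x := z)
  have dC := ((contDiff_realCn hm1).comp hre).contDiffAt (x := z)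
  have dD := ((contDiff_realDn hm1).comp hre).contDiffAt (x := z)
  have ds := ((contDiff_realSn (one_sub_ne_one hm0)).comp him).contDiffAt (x := z)
  have dc := ((contDiff_realCn (one_sub_ne_one hm0)).comp him).contDiffAt (x := z)
  have dd := ((contDiff_realDn (one_sub_ne_one hm0)).comp him).contDiffAt (x := z)
  refine ContDiffAt.smul (contDiffAt_const.div (dD.mul ds) hz) (contDiffAt_pi.2 fun j => ?_)
  fin_cases j
  · exact (contDiffAt_const.mul dC).mul dc
  · exact (contDiffAt_const.mul dS).mul dd
  · exact contDiffAt_const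

lemma hasFDerivAt_hyperboloidParam {m : ℝ} (hm0 : m ≠ 0) (hm1 : m ≠ 1) (a b c : ℝ) {z : ℂ}
    (hz : z ∈ paramDomain m) :
    HasFDerivAt (hyperboloidParam a b c m) (frame (paramU a b c m z) (paramV a b c m z)) z := by
  have h1 := realSn_sq_add_realCn_sq hm1 z.re
  have h2 := realDn_sq_add (m := m) z.re
  have h3 := realSn_sq_add_realCn_sq (one_sub_ne_one hm0) z.im
  have h4 := realDn_sq_add (m := 1 - m) z.im
  have hS := hasFDerivAt_re (hasDerivAt_realSn hm1 z.re)
  have hC := hasFDerivAt_re (hasDerivAt_realCn hm1 z.re)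
  have hD := hasFDerivAt_re (hasDerivAt_realDn hm1 z.re)
  have hs := hasFDerivAt_im (hasDerivAt_realSn (one_sub_ne_one hm0) z.im)
  have hc := hasFDerivAt_im (hasDerivAt_realCn (one_sub_ne_one hm0) z.im)
  have hd := hasFDerivAt_im (hasDerivAt_realDn (one_sub_ne_one hm0) z.im)
  have hD0 : realDn m z.re ≠ 0 := left_ne_zero_of_mul hz
  have hs0 : realSn (1 - m) z.im ≠ 0 := right_ne_zero_of_mul hz
  have hQ := hD.fun_mul hs
  refine hasFDerivAt_pi'.2 fun j => ?_
  fin_cases j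
  · have h := hasFDerivAt_div ((hC.fun_mul hc).const_mul a) hQ hz
    refine (h.congr_fderiv ?_).congr_of_eventuallyEq (.of_forall fun w => ?_)
    · ext X
      simp [frame_apply, paramU, paramV]
      generalize realSn m z.re = S at *
      generalize realCn m z.re = C at *
      generalize realDn m z.re = D at *
      generalize realSn (1 - m) z.im = s at *
      generalize realCn (1 - m) z.im = c at *
      generalize realDn (1 - m) z.im = d at *
      clear * - h1 h2 h3 h4 hD0 hs0
      field_simp
      grind
    · simp [hyperboloidParam]
      ring
  · have h := hasFDerivAt_div ((hS.fun_mul hd).const_mul b) hQ hz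
    refine (h.congr_fderiv ?_).congr_of_eventuallyEq (.of_forall fun w => ?_)
    · ext X
      simp [frame_apply, paramU, paramV]
      generalize realSn m z.re = S at *
      generalize realCn m z.re = C at *
      generalize realDn m z.re = D at *
      generalize realSn (1 - m) z.im = s at *
      generalize realCn (1 - m) z.im = c at *
      generalize realDn (1 - m) z.im = d at *
      clear * - h1 h2 h3 h4 hD0 hs0
      field_simp
      grind
    · simp [hyperboloidParam]
      ring
  · have h := hasFDerivAt_div (hasFDerivAt_const c z) hQ hz
    refine (h.congr_fderiv ?_).congr_of_eventuallyEq (.of_forall fun w => ?_)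
    · ext X
      simp [frame_apply, paramU, paramV]
      generalize realSn m z.re = S at *
      generalize realCn m z.re = C at *
      generalize realDn m z.re = D at *
      generalize realSn (1 - m) z.im = s at *
      generalize realCn (1 - m) z.im = c at *
      generalize realDn (1 - m) z.im = d at *
      clear * - h1 h2 h3 h4 hD0 hs0
      field_simp
    · simp [hyperboloidParam]
      ring

lemma hasFDerivAt_paramNormal {m : ℝ} (hm0 : m ≠ 0) (hm1 : m ≠ 1) (a b c : ℝ) (z : ℂ) :
    HasFDerivAt (paramNormal a b c m) (frame (normalU a b m z) (normalV a b m z)) z := by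
  have hS := hasFDerivAt_re (hasDerivAt_realSn hm1 z.re)
  have hC := hasFDerivAt_re (hasDerivAt_realCn hm1 z.re)
  have hc := hasFDerivAt_im (hasDerivAt_realCn (one_sub_ne_one hm0) z.im)
  have hd := hasFDerivAt_im (hasDerivAt_realDn (one_sub_ne_one hm0) z.im)
  refine hasFDerivAt_pi'.2 fun j => ?_
  fin_cases j
  · refine (((hC.fun_mul hc).mul_const (1 / a)).congr_fderiv ?_).congr_of_eventuallyEq
      (.of_forall fun w => ?_)
    · ext X
      simp [frame_apply, normalU, normalV]
      ring
    · simp [paramNormal]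
      ring
  · refine (((hS.fun_mul hd).mul_const (1 / b)).congr_fderiv ?_).congr_of_eventuallyEq
      (.of_forall fun w => ?_)
    · ext X
      simp [frame_apply, normalU, normalV]
      ring
    · simp [paramNormal]
      ring
  · refine ((hasFDerivAt_const (-(1 / c)) z).congr_fderiv ?_).congr_of_eventuallyEq
      (.of_forall fun w => ?_)
    · ext X
      simp [frame_apply, normalU, normalV]
    · simp [paramNormal]

section Algebra

variable {a b c m : ℝ} {z : ℂ}

lemma paramNormal_dot_paramU (hm0 : m ≠ 0) (hm1 : m ≠ 1) (ha : a ≠ 0) (hb : b ≠ 0) (hc : c ≠ 0) :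
    paramNormal a b c m z ⬝ᵥ paramU a b c m z = 0 := by
  have h1 := realSn_sq_add_realCn_sq hm1 z.re
  have h2 := realDn_sq_add (m := m) z.re
  have h3 := realSn_sq_add_realCn_sq (one_sub_ne_one hm0) z.im
  have h4 := realDn_sq_add (m := 1 - m) z.im
  simp [paramNormal, paramU, dotProduct, Fin.sum_univ_three]
  field_simp
  grind

lemma paramNormal_dot_paramV (hm0 : m ≠ 0) (hm1 : m ≠ 1) (ha : a ≠ 0) (hb : b ≠ 0) (hc : c ≠ 0) :
    paramNormal a b c m z ⬝ᵥ paramV a b c m z = 0 := by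
  have h1 := realSn_sq_add_realCn_sq hm1 z.re
  have h2 := realDn_sq_add (m := m) z.re
  have h3 := realSn_sq_add_realCn_sq (one_sub_ne_one hm0) z.im
  have h4 := realDn_sq_add (m := 1 - m) z.im
  simp [paramNormal, paramV, dotProduct, Fin.sum_univ_three]
  field_simp
  grind

lemma normalV_dot_paramU (ha : a ≠ 0) (hb : b ≠ 0) :
    normalV a b m z ⬝ᵥ paramU a b c m z = 0 := by
  simp [normalV, paramU, dotProduct, Fin.sum_univ_three]
  field_simp
  ring

lemma normalU_dot_paramV (ha : a ≠ 0) (hb : b ≠ 0) :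
    normalU a b m z ⬝ᵥ paramV a b c m z = 0 := by
  simp [normalU, paramV, dotProduct, Fin.sum_univ_three]
  field_simp
  ring

lemma normalU_dot_paramU (hm0 : m ≠ 0) (hm1 : m ≠ 1) (ha : a ≠ 0) (hb : b ≠ 0)
    (hz : z ∈ paramDomain m) : normalU a b m z ⬝ᵥ paramU a b c m z
      = conformalFactor m z / (realDn m z.re * realSn (1 - m) z.im) := by
  have h1 := realSn_sq_add_realCn_sq hm1 z.re
  have h3 := realSn_sq_add_realCn_sq (one_sub_ne_one hm0) z.im
  have h4 := realDn_sq_add (m := 1 - m) z.im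
  have hD0 : realDn m z.re ≠ 0 := left_ne_zero_of_mul hz
  have hs0 : realSn (1 - m) z.im ≠ 0 := right_ne_zero_of_mul hz
  simp [normalU, paramU, dotProduct, Fin.sum_univ_three, conformalFactor]
  field_simp
  grind

lemma normalV_dot_paramV (hm0 : m ≠ 0) (hm1 : m ≠ 1) (ha : a ≠ 0) (hb : b ≠ 0)
    (hz : z ∈ paramDomain m) : normalV a b m z ⬝ᵥ paramV a b c m z
      = conformalFactor m z / (realDn m z.re * realSn (1 - m) z.im) := by
  have h1 := realSn_sq_add_realCn_sq hm1 z.re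
  have h3 := realSn_sq_add_realCn_sq (one_sub_ne_one hm0) z.im
  have h4 := realDn_sq_add (m := 1 - m) z.im
  have hD0 : realDn m z.re ≠ 0 := left_ne_zero_of_mul hz
  have hs0 : realSn (1 - m) z.im ≠ 0 := right_ne_zero_of_mul hz
  simp [normalV, paramV, dotProduct, Fin.sum_univ_three, conformalFactor]
  field_simp
  grind

lemma paramU_paramV_minor (hm0 : m ≠ 0) (hm1 : m ≠ 1) (hz : z ∈ paramDomain m) :
    paramU a b c m z 0 * paramV a b c m z 1 - paramU a b c m z 1 * paramV a b c m z 0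
      = a * b * conformalFactor m z / (realDn m z.re * realSn (1 - m) z.im) ^ 3 := by
  have h1 := realSn_sq_add_realCn_sq hm1 z.re
  have h3 := realSn_sq_add_realCn_sq (one_sub_ne_one hm0) z.im
  have h4 := realDn_sq_add (m := 1 - m) z.im
  have hD0 : realDn m z.re ≠ 0 := left_ne_zero_of_mul hz
  have hs0 : realSn (1 - m) z.im ≠ 0 := right_ne_zero_of_mul hz
  simp [paramU, paramV, conformalFactor]
  field_simp
  grind

/-- The coefficient `E` of the first fundamental form of the hyperboloid. Away from the umbilics its
sign is that of a function of `u` alone. -/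
lemma mink_paramU_paramU (hm0 : m ≠ 0) (hm1 : m ≠ 1) (hm : (a ^ 2 - c ^ 2) * m = a ^ 2 - b ^ 2)
    (hz : z ∈ paramDomain m) : mink (paramU a b c m z) (paramU a b c m z)
      = conformalFactor m z * (c ^ 2 * realDn m z.re ^ 2 + (1 - m) * (a ^ 2 - c ^ 2))
        / (realDn m z.re ^ 4 * realSn (1 - m) z.im ^ 2) := by
  have h1 := realSn_sq_add_realCn_sq hm1 z.re
  have h2 := realDn_sq_add (m := m) z.re
  have h3 := realSn_sq_add_realCn_sq (one_sub_ne_one hm0) z.im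
  have h4 := realDn_sq_add (m := 1 - m) z.im
  have hD0 : realDn m z.re ≠ 0 := left_ne_zero_of_mul hz
  have hs0 : realSn (1 - m) z.im ≠ 0 := right_ne_zero_of_mul hz
  simp [mink, paramU, conformalFactor]
  field_simp
  grind

lemma mink_paramV_paramV (hm0 : m ≠ 0) (hm1 : m ≠ 1) (hm : (a ^ 2 - c ^ 2) * m = a ^ 2 - b ^ 2)
    (hz : z ∈ paramDomain m) : mink (paramV a b c m z) (paramV a b c m z)
      = conformalFactor m z * (c ^ 2 * realSn (1 - m) z.im ^ 2 + (a ^ 2 - c ^ 2))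
        / (realDn m z.re ^ 2 * realSn (1 - m) z.im ^ 4) := by
  have h1 := realSn_sq_add_realCn_sq hm1 z.re
  have h2 := realDn_sq_add (m := m) z.re
  have h3 := realSn_sq_add_realCn_sq (one_sub_ne_one hm0) z.im
  have h4 := realDn_sq_add (m := 1 - m) z.im
  have hD0 : realDn m z.re ≠ 0 := left_ne_zero_of_mul hz
  have hs0 : realSn (1 - m) z.im ≠ 0 := right_ne_zero_of_mul hz
  simp [mink, paramV, conformalFactor]
  field_simp
  grind

lemma mink_paramU_paramV (hm : (a ^ 2 - c ^ 2) * m = a ^ 2 - b ^ 2) :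
    mink (paramU a b c m z) (paramV a b c m z) = 0 := by
  simp [mink, paramU, paramV]
  grind

end Algebra

/-! ### The branches and their derivatives -/

section Branch

variable {m : ℝ} {p q : ℂ} {V : Set ℂ} {f₁ f₂ f₃ : ℂ → ℂ} {z : ℂ}

lemma ne_zero_of_sq_eq (hm0 : m ≠ 0) (hp : p ^ 2 = m) : p ≠ 0 := by
  rintro rfl
  exact hm0 (by simpa using hp.symm)

lemma ne_zero_of_sq_eq_one_sub (hm1 : m ≠ 1) (hq : q ^ 2 = 1 - m) : q ≠ 0 := by
  rintro rfl
  have h : (1 : ℂ) - m = 0 := by simpa using hq.symm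
  exact hm1 (by exact_mod_cast (sub_eq_zero.1 h).symm)

lemma one_sub_invSn_sq (hm0 : m ≠ 0) (hp : p ^ 2 = m) :
    1 - (invSn m z / p) ^ 2 = (m + (-1) * invSn m z ^ 2) / m := by
  have : (m : ℂ) ≠ 0 := by exact_mod_cast hm0
  rw [div_pow, hp]
  field_simp
  ring

lemma one_sub_invCn_sq (hm0 : m ≠ 0) (hp : p ^ 2 = m) (hq : q ^ 2 = 1 - m) :
    1 - (q / (Complex.I * p) * invCn m z) ^ 2 = (m + (1 - m) * invCn m z ^ 2) / m := by
  have : (m : ℂ) ≠ 0 := by exact_mod_cast hm0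
  rw [mul_pow, div_pow, mul_pow, hp, hq, Complex.I_sq]
  field_simp
  ring

lemma one_sub_snDivCn_sq (hq : q ^ 2 = 1 - m) :
    1 - (q / Complex.I * snDivCn m z) ^ 2 = 1 + (1 - m) * snDivCn m z ^ 2 := by
  rw [mul_pow, div_pow, hq, Complex.I_sq]
  ring

lemma one_sub_invSn_sq_ne_zero (hm0 : m ≠ 0) (hm1 : m ≠ 1) (hp : p ^ 2 = m)
    (hz : z ∈ regularDomain m) : 1 - (invSn m z / p) ^ 2 ≠ 0 := by
  rw [one_sub_invSn_sq hm0 hp]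
  refine div_ne_zero (fun h => ?_) (by exact_mod_cast hm0)
  have := invSn_relation hm0 hm1 hz
  rw [h, zero_mul] at this
  norm_num at this

lemma one_sub_invCn_sq_ne_zero (hm0 : m ≠ 0) (hm1 : m ≠ 1) (hp : p ^ 2 = m) (hq : q ^ 2 = 1 - m)
    (hz : z ∈ regularDomain m) : 1 - (q / (Complex.I * p) * invCn m z) ^ 2 ≠ 0 := by
  rw [one_sub_invCn_sq hm0 hp hq]
  refine div_ne_zero (fun h => ?_) (by exact_mod_cast hm0)
  simpa [h] using invCn_relation hm0 hm1 hz

lemma one_sub_snDivCn_sq_ne_zero (hm0 : m ≠ 0) (hm1 : m ≠ 1) (hq : q ^ 2 = 1 - m)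
    (hz : z ∈ regularDomain m) : 1 - (q / Complex.I * snDivCn m z) ^ 2 ≠ 0 := by
  rw [one_sub_snDivCn_sq hq]
  intro h
  simpa [h] using snDivCn_relation hm0 hm1 hz

/-- Branches of the three multivalued functions exist on simply connected domains, also across the
poles, since the arguments of `arctan` and `artanh` extend holomorphically to the poles. -/
lemma exists_isBranch (hm0 : m ≠ 0) (hm1 : m ≠ 1) (hp : p ^ 2 = m) (hq : q ^ 2 = 1 - m)
    (hV : IsOpen V) (hs : SimplyConnectedSpace V) (hsub : V ⊆ regularDomain m) :
    ∃ f₁ f₂ f₃ : ℂ → ℂ, IsBranch m p q V f₁ f₂ f₃ := by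
  have c1 : ContinuousOn (fun w => invSn m w / p) V := fun w hw =>
    ((hasDerivAt_invSn hm0 hm1 (hsub hw)).div_const p).continuousAt.continuousWithinAt
  have c2 : ContinuousOn (fun w => q / (Complex.I * p) * invCn m w) V := fun w hw =>
    ((hasDerivAt_invCn hm0 hm1 (hsub hw)).const_mul _).continuousAt.continuousWithinAt
  have c3 : ContinuousOn (fun w => q / Complex.I * snDivCn m w) V := fun w hw =>
    ((hasDerivAt_snDivCn hm0 hm1 (hsub hw)).const_mul _).continuousAt.continuousWithinAt
  obtain ⟨h₁, hc₁, ht₁⟩ := exists_continuousOn_tanh_eq hV hs c1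
    fun w hw => one_sub_invSn_sq_ne_zero hm0 hm1 hp (hsub hw)
  obtain ⟨h₂, hc₂, ht₂⟩ := exists_continuousOn_tanh_eq hV hs c2
    fun w hw => one_sub_invCn_sq_ne_zero hm0 hm1 hp hq (hsub hw)
  obtain ⟨h₃, hc₃, ht₃⟩ := exists_continuousOn_tanh_eq hV hs c3
    fun w hw => one_sub_snDivCn_sq_ne_zero hm0 hm1 hq (hsub hw)
  refine ⟨fun w => -(h₁ w * Complex.I), h₂, h₃, (hc₁.mul continuousOn_const).neg, hc₂, hc₃,
    fun w hw hd => ?_, fun w hw hd => ?_, fun w hw hd => ?_⟩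
  · rw [Complex.tan_neg, Complex.tan_mul_I, ht₁ w hw, (quotients_eq hm0 hm1 (hsub hw).1 hd).1.1,
      ← div_eq_mul_inv, one_div_div, mul_comm Complex.I p, ← div_div, Complex.div_I]
  · rw [ht₂ w hw, (quotients_eq hm0 hm1 (hsub hw).1 hd).2.1.1, ← div_eq_mul_inv, div_div_eq_mul_div]
    ring
  · rw [ht₃ w hw, (quotients_eq hm0 hm1 (hsub hw).1 hd).2.2.1]

lemma hasDerivAt_branch₁ (hm0 : m ≠ 0) (hm1 : m ≠ 1) (hp : p ^ 2 = m)
    (hV : IsOpen V) (hsub : V ⊆ regularDomain m) (hf : IsBranch m p q V f₁ f₂ f₃) (hz : z ∈ V) :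
    HasDerivAt f₁ (-Complex.I * p * cnDivDn m z) z := by
  have hp0 := ne_zero_of_sq_eq hm0 hp
  have hd : ∀ w ∈ V, HasDerivAt (fun w => invSn m w / p) _ w := fun w hw =>
    (hasDerivAt_invSn hm0 hm1 (hsub hw)).div_const p
  have h := hasDerivAt_of_tanh_eq hV (h := fun w => f₁ w * Complex.I)
    (hf.cont₁.mul continuousOn_const) (fun w hw => (hd w hw).differentiableAt)
    (fun w hw => one_sub_invSn_sq_ne_zero hm0 hm1 hp (hsub hw)) (fun w hw => ?_) hz (hd z hz)
  · have h' := h.mul_const (-Complex.I)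
    have e : (fun w => f₁ w * Complex.I * -Complex.I) = f₁ := by
      funext w
      linear_combination (-f₁ w) * Complex.I_sq
    rw [e] at h'
    refine h'.congr_deriv ?_
    have hn := one_sub_invSn_sq_ne_zero hm0 hm1 hp (hsub hz)
    rw [one_sub_invSn_sq hm0 hp] at hn ⊢
    have hn' := (div_ne_zero_iff.1 hn).1
    have hm : (m : ℂ) ≠ 0 := by exact_mod_cast hm0
    generalize (m : ℂ) + -1 * invSn m z ^ 2 = r at hn'
    rw [← hp] at hm ⊢
    field_simp
  · refine ((frequently_jacobiDen_ne_zero hm0 hm1 w).and_eventually (hV.mem_nhds hw)).mono ?_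
    rintro y ⟨hy, hyV⟩
    obtain ⟨⟨h1, h2⟩, -⟩ := quotients_eq hm0 hm1 (hsub hyV).1 hy
    refine ⟨div_ne_zero h2 hp0, ?_⟩
    rw [Complex.tanh_mul_I, hf.tan₁ y hyV hy, h1, ← div_eq_mul_inv, one_div_div, div_mul_eq_mul_div,
      mul_comm (invSn m y), mul_div_mul_left _ _ Complex.I_ne_zero]

lemma hasDerivAt_branch₂ (hm0 : m ≠ 0) (hm1 : m ≠ 1) (hp : p ^ 2 = m) (hq : q ^ 2 = 1 - m)
    (hV : IsOpen V) (hsub : V ⊆ regularDomain m) (hf : IsBranch m p q V f₁ f₂ f₃) (hz : z ∈ V) :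
    HasDerivAt f₂ (-Complex.I * p * q * snDivDn m z) z := by
  have hp0 := ne_zero_of_sq_eq hm0 hp
  have hq0 := ne_zero_of_sq_eq_one_sub hm1 hq
  have hd : ∀ w ∈ V, HasDerivAt (fun w => q / (Complex.I * p) * invCn m w) _ w := fun w hw =>
    (hasDerivAt_invCn hm0 hm1 (hsub hw)).const_mul _
  have h := hasDerivAt_of_tanh_eq hV hf.cont₂ (fun w hw => (hd w hw).differentiableAt)
    (fun w hw => one_sub_invCn_sq_ne_zero hm0 hm1 hp hq (hsub hw)) (fun w hw => ?_) hz (hd z hz)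
  · refine h.congr_deriv ?_
    have hn := one_sub_invCn_sq_ne_zero hm0 hm1 hp hq (hsub hz)
    rw [one_sub_invCn_sq hm0 hp hq] at hn ⊢
    have hn' := (div_ne_zero_iff.1 hn).1
    have hm : (m : ℂ) ≠ 0 := by exact_mod_cast hm0
    have e : q / (Complex.I * p) = -Complex.I * q / p := by
      rw [← div_div, Complex.div_I]
      ring
    rw [e]
    rw [← hp] at hn' hm ⊢
    field_simp
  · refine ((frequently_jacobiDen_ne_zero hm0 hm1 w).and_eventually (hV.mem_nhds hw)).mono ?_
    rintro y ⟨hy, hyV⟩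
    obtain ⟨-, ⟨h1, h2⟩, -⟩ := quotients_eq hm0 hm1 (hsub hyV).1 hy
    refine ⟨mul_ne_zero (div_ne_zero hq0 (mul_ne_zero Complex.I_ne_zero hp0)) h2, ?_⟩
    rw [hf.tanh₂ y hyV hy, h1, ← div_eq_mul_inv, div_div_eq_mul_div]
    ring

lemma hasDerivAt_branch₃ (hm0 : m ≠ 0) (hm1 : m ≠ 1) (hq : q ^ 2 = 1 - m)
    (hV : IsOpen V) (hsub : V ⊆ regularDomain m) (hf : IsBranch m p q V f₁ f₂ f₃) (hz : z ∈ V) :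
    HasDerivAt f₃ (-Complex.I * q * invDn m z) z := by
  have hq0 := ne_zero_of_sq_eq_one_sub hm1 hq
  have hd : ∀ w ∈ V, HasDerivAt (fun w => q / Complex.I * snDivCn m w) _ w := fun w hw =>
    (hasDerivAt_snDivCn hm0 hm1 (hsub hw)).const_mul _
  have h := hasDerivAt_of_tanh_eq hV hf.cont₃ (fun w hw => (hd w hw).differentiableAt)
    (fun w hw => one_sub_snDivCn_sq_ne_zero hm0 hm1 hq (hsub hw)) (fun w hw => ?_) hz (hd z hz)
  · refine h.congr_deriv ?_
    have hn := one_sub_snDivCn_sq_ne_zero hm0 hm1 hq (hsub hz)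
    rw [one_sub_snDivCn_sq hq] at hn ⊢
    rw [Complex.div_I]
    field_simp
  · refine ((frequently_jacobiDen_ne_zero hm0 hm1 w).and_eventually (hV.mem_nhds hw)).mono ?_
    rintro y ⟨hy, hyV⟩
    obtain ⟨-, -, h1, h2⟩ := quotients_eq hm0 hm1 (hsub hyV).1 hy
    exact ⟨mul_ne_zero (div_ne_zero hq0 Complex.I_ne_zero) h2, by rw [hf.tanh₃ y hyV hy, h1]⟩

end Branch

/-! ### The dual surface -/

lemma cnDivDn_eq (m : ℝ) (z : ℂ) : cnDivDn m z
    = ⟨realCn m z.re * realDn m z.re * realDn (1 - m) z.im / conformalFactor m z,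
      -((1 - m) * realSn m z.re * realSn (1 - m) z.im * realCn (1 - m) z.im)
        / conformalFactor m z⟩ := by
  rw [Complex.mk_eq_add_mul_I, cnDivDn]
  push_cast
  ring

lemma snDivDn_eq (m : ℝ) (z : ℂ) : snDivDn m z
    = ⟨realSn m z.re * realDn m z.re * realCn (1 - m) z.im / conformalFactor m z,
      realCn m z.re * realSn (1 - m) z.im * realDn (1 - m) z.im / conformalFactor m z⟩ := by
  rw [Complex.mk_eq_add_mul_I, snDivDn]
  push_cast
  ring

lemma invDn_eq (m : ℝ) (z : ℂ) : invDn m z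
    = ⟨realDn m z.re * realCn (1 - m) z.im * realDn (1 - m) z.im / conformalFactor m z,
      m * realSn m z.re * realCn m z.re * realSn (1 - m) z.im / conformalFactor m z⟩ := by
  rw [Complex.mk_eq_add_mul_I, invDn]
  push_cast
  ring

/-- The ratio of the lengths of corresponding tangent vectors of the hyperboloid and its dual. -/
def stretch (m : ℝ) (z : ℂ) : ℝ :=
  2 * (realDn m z.re * realSn (1 - m) z.im) ^ 2 / conformalFactor m z

section Dual

variable {a b c m : ℝ} {p q : ℂ} {V : Set ℂ} {f₁ f₂ f₃ : ℂ → ℂ} {z : ℂ}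

lemma stretch_pos (hm0 : m ≠ 0) (hm1 : m ≠ 1) (hz : z ∈ regularDomain m) : 0 < stretch m z := by
  have h1 := conformalFactor_pos hm0 hm1 hz
  have h2 : realDn m z.re * realSn (1 - m) z.im ≠ 0 := hz.1
  unfold stretch
  positivity

/-- The components of the formula for the dual surface, before real parts are taken. -/
def dualHolomorphic (a b c : ℝ) (p q : ℂ) (f₁ f₂ f₃ : ℂ → ℂ) : Fin 3 → ℂ → ℂ :=
  ![fun z => 2 * a / p * f₁ z, fun z => 2 * b / (p * q) * f₂ z, fun z => 2 * c / q * f₃ z]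

lemma dualFormula_eq :
    dualFormula a b c p q f₁ f₂ f₃ = fun z j => (dualHolomorphic a b c p q f₁ f₂ f₃ j z).re := by
  funext z j
  fin_cases j <;> rfl

/-- The differential of the dual surface is `Re (-2 i (a cn, b sn, c) / dn dz)`. -/
lemma hasDerivAt_dualHolomorphic (hm0 : m ≠ 0) (hm1 : m ≠ 1) (hp : p ^ 2 = m) (hq : q ^ 2 = 1 - m)
    (hV : IsOpen V) (hsub : V ⊆ regularDomain m) (hf : IsBranch m p q V f₁ f₂ f₃) (hz : z ∈ V)
    (j : Fin 3) : HasDerivAt (dualHolomorphic a b c p q f₁ f₂ f₃ j)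
      (-2 * Complex.I * (![a * cnDivDn m z, b * snDivDn m z, c * invDn m z] : Fin 3 → ℂ) j) z := by
  have hp0 := ne_zero_of_sq_eq hm0 hp
  have hq0 := ne_zero_of_sq_eq_one_sub hm1 hq
  fin_cases j
  · refine ((hasDerivAt_branch₁ hm0 hm1 hp hV hsub hf hz).const_mul (2 * a / p : ℂ)).congr_deriv ?_
    simp
    field_simp
  · refine ((hasDerivAt_branch₂ hm0 hm1 hp hq hV hsub hf hz).const_mul
      (2 * b / (p * q) : ℂ)).congr_deriv ?_
    simp
    field_simp
  · refine ((hasDerivAt_branch₃ hm0 hm1 hq hV hsub hf hz).const_mul (2 * c / q : ℂ)).congr_deriv ?_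
    simp
    field_simp

lemma contDiffOn_dualFormula (hm0 : m ≠ 0) (hm1 : m ≠ 1) (hp : p ^ 2 = m) (hq : q ^ 2 = 1 - m)
    (hV : IsOpen V) (hsub : V ⊆ regularDomain m) (hf : IsBranch m p q V f₁ f₂ f₃) :
    ContDiffOn ℝ ∞ (dualFormula a b c p q f₁ f₂ f₃) V := by
  rw [dualFormula_eq]
  refine contDiffOn_pi.2 fun j => ?_
  have h : DifferentiableOn ℂ (dualHolomorphic a b c p q f₁ f₂ f₃ j) V := fun w hw =>
    have h' := hasDerivAt_dualHolomorphic hm0 hm1 hp hq hV hsub hf hw j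
    h'.differentiableAt.differentiableWithinAt
  exact Complex.reCLM.contDiff.comp_contDiffOn ((h.contDiffOn hV).restrict_scalars ℝ)

lemma hasFDerivAt_dualFormula (hm0 : m ≠ 0) (hm1 : m ≠ 1) (hp : p ^ 2 = m) (hq : q ^ 2 = 1 - m)
    (hV : IsOpen V) (hsub : V ⊆ regularDomain m) (hf : IsBranch m p q V f₁ f₂ f₃) (hz : z ∈ V) :
    HasFDerivAt (dualFormula a b c p q f₁ f₂ f₃)
      (frame (stretch m z • paramU a b c m z) (-stretch m z • paramV a b c m z)) z := by
  rw [dualFormula_eq]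
  have hW := (conformalFactor_pos hm0 hm1 (hsub hz)).ne'
  have hD0 : realDn m z.re ≠ 0 := left_ne_zero_of_mul (hsub hz).1
  have hs0 : realSn (1 - m) z.im ≠ 0 := right_ne_zero_of_mul (hsub hz).1
  refine hasFDerivAt_pi'.2 fun j => ?_
  refine (Complex.reCLM.hasFDerivAt.comp z ((hasDerivAt_dualHolomorphic hm0 hm1 hp hq hV hsub hf
    hz j).hasFDerivAt.restrictScalars ℝ)).congr_fderiv ?_
  ext X
  fin_cases j <;>
  · simp [frame_apply, stretch, paramU, paramV, cnDivDn_eq, snDivDn_eq, invDn_eq]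
    field_simp
    ring

end Dual

/-! ### The image of the parametrization -/

lemma exists_interlacing_roots {e₁ e₂ e₃ s t : ℝ} (h₁₂ : e₁ < e₂) (h₂₃ : e₂ < e₃)
    (h₁ : 0 ≤ e₁ ^ 2 - s * e₁ + t) (h₂ : e₂ ^ 2 - s * e₂ + t ≤ 0)
    (h₃ : 0 ≤ e₃ ^ 2 - s * e₃ + t) :
    ∃ r₁ r₂ : ℝ, e₁ ≤ r₁ ∧ r₁ ≤ e₂ ∧ e₂ ≤ r₂ ∧ r₂ ≤ e₃ ∧ r₁ + r₂ = s ∧ r₁ * r₂ = t := by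
  have hd : 0 ≤ s ^ 2 - 4 * t := by nlinarith [sq_nonneg (2 * e₂ - s)]
  have hq := Real.sq_sqrt hd
  have hr := Real.sqrt_nonneg (s ^ 2 - 4 * t)
  set r := √(s ^ 2 - 4 * t)
  have f : ∀ e, e ^ 2 - s * e + t = (e - (s - r) / 2) * (e - (s + r) / 2) := by
    intro e
    linear_combination (1 / 4) * hq
  rw [f] at h₁ h₂ h₃
  have h4 : (s - r) / 2 ≤ e₂ := by
    by_contra h
    nlinarith [mul_pos_of_neg_of_neg (show e₂ - (s - r) / 2 < 0 by linarith)
      (show e₂ - (s + r) / 2 < 0 by linarith)]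
  have h5 : e₂ ≤ (s + r) / 2 := by
    by_contra h
    nlinarith [mul_pos (show 0 < e₂ - (s - r) / 2 by linarith)
      (show 0 < e₂ - (s + r) / 2 by linarith)]
  refine ⟨(s - r) / 2, (s + r) / 2, ?_, h4, h5, ?_, by ring, by linear_combination -(1 / 4) * hq⟩
  · by_contra h
    nlinarith [mul_neg_of_pos_of_neg (show 0 < e₁ - (s - r) / 2 by linarith)
      (show e₁ - (s + r) / 2 < 0 by linarith)]
  · by_contra h
    nlinarith [mul_neg_of_pos_of_neg (show 0 < e₃ - (s - r) / 2 by linarith)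
      (show e₃ - (s + r) / 2 < 0 by linarith)]

/-- Elliptic (sphero-conal) coordinates on the unit sphere, in terms of `σ = sn² u`, `τ = sn'² v`.
The numbers `σ` and `(1 - (1 - m) τ) / m` are the roots of the polynomial
`X² t (t - 1 / m) + Y² (t - 1) (t - 1 / m) + Z² t (t - 1)`; they are separated by the middle one of
the numbers `0`, `1`, `1 / m`, whose order depends on `m`. -/
lemma exists_spheroconal {m X Y Z : ℝ} (hm0 : m ≠ 0) (hm1 : m ≠ 1)
    (h : X ^ 2 + Y ^ 2 + Z ^ 2 = 1) :
    ∃ σ τ : ℝ, (0 ≤ σ ∧ σ ≤ 1 ∧ m * σ ≤ 1) ∧ (0 ≤ τ ∧ τ ≤ 1 ∧ (1 - m) * τ ≤ 1) ∧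
      (1 - σ) * (1 - τ) = X ^ 2 ∧ σ * (1 - (1 - m) * τ) = Y ^ 2 ∧ (1 - m * σ) * τ = Z ^ 2 := by
  obtain ⟨k, hk⟩ : ∃ k, k * m = 1 := ⟨m⁻¹, inv_mul_cancel₀ hm0⟩
  have hX := sq_nonneg X
  have hY := sq_nonneg Y
  have hZ := sq_nonneg Z
  have hm1' : 1 - m ≠ 0 := sub_ne_zero.2 hm1.symm
  suffices H : ∃ σ ρ : ℝ, σ + ρ = k * X ^ 2 + (1 + k) * Y ^ 2 + Z ^ 2 ∧ σ * ρ = k * Y ^ 2 ∧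
      (0 ≤ σ ∧ σ ≤ 1 ∧ m * σ ≤ 1) ∧ 0 ≤ (1 - m * ρ) / (1 - m) ∧ (1 - m * ρ) / (1 - m) ≤ 1 ∧
        0 ≤ m * ρ by
    obtain ⟨σ, ρ, hs, ht, hσ, h1, h2, h3⟩ := H
    refine ⟨σ, (1 - m * ρ) / (1 - m), hσ, ⟨h1, h2, ?_⟩, ?_, ?_, ?_⟩
    · rw [mul_div_cancel₀ _ hm1']; linarith
    · field_simp
      grind
    · rw [mul_div_cancel₀ _ hm1']
      grind
    · field_simp
      grind
  -- the values of the polynomial at `0`, `1` and `k = 1 / m`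
  have q0 : (0 : ℝ) ^ 2 - (k * X ^ 2 + (1 + k) * Y ^ 2 + Z ^ 2) * 0 + k * Y ^ 2
      = k * Y ^ 2 := by ring
  have q1 : (1 : ℝ) ^ 2 - (k * X ^ 2 + (1 + k) * Y ^ 2 + Z ^ 2) * 1 + k * Y ^ 2
      = (1 - k) * X ^ 2 := by linear_combination -h
  have qk : k ^ 2 - (k * X ^ 2 + (1 + k) * Y ^ 2 + Z ^ 2) * k + k * Y ^ 2
      = k * (k - 1) * Z ^ 2 := by linear_combination (-k ^ 2) * h
  rcases lt_trichotomy m 0 with hm | hm | hm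
  · have hk0 : k < 0 := by nlinarith
    obtain ⟨ρ, σ, h1, h2, h3, h4, h5, h6⟩ := exists_interlacing_roots hk0 one_pos
      (by
        rw [qk]
        exact mul_nonneg (mul_pos_of_neg_of_neg hk0 (by linarith : k - 1 < 0)).le hZ)
      (by rw [q0]; nlinarith) (by rw [q1]; nlinarith)
    refine ⟨σ, ρ, by linarith, by linarith, ⟨h3, h4, by nlinarith⟩, div_nonneg ?_ (by linarith),
      (div_le_one (by linarith)).2 ?_, ?_⟩ <;> nlinarith
  · exact absurd hm hm0
  have hk0 : 0 < k := by by_contra hk0; nlinarith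
  rcases lt_or_gt_of_ne hm1 with hm' | hm'
  · have hk1 : 1 < k := by by_contra hk1; nlinarith
    obtain ⟨σ, ρ, h1, h2, h3, h4, h5, h6⟩ := exists_interlacing_roots one_pos hk1
      (by rw [q0]; positivity) (by rw [q1]; nlinarith)
      (by rw [qk]; exact mul_nonneg (mul_nonneg hk0.le (by linarith)) hZ)
    refine ⟨σ, ρ, h5, h6, ⟨h1, h2, by nlinarith⟩, div_nonneg ?_ (by linarith),
      (div_le_one (by linarith)).2 ?_, ?_⟩ <;> nlinarith
  · have hk1 : k < 1 := by by_contra hk1; nlinarith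
    obtain ⟨σ, ρ, h1, h2, h3, h4, h5, h6⟩ := exists_interlacing_roots hk0 hk1
      (by rw [q0]; positivity)
      (by rw [qk]; nlinarith [mul_nonneg (mul_nonneg hk0.le (by linarith : 0 ≤ 1 - k)) hZ])
      (by rw [q1]; nlinarith)
    refine ⟨σ, ρ, h5, h6, ⟨h1, by linarith, by nlinarith⟩,
      div_nonneg_of_nonpos ?_ (by linarith), (div_le_one_of_neg (by linarith)).2 ?_, ?_⟩ <;>
      nlinarith

/-- A real argument with given `sn²`. The sign of `sn` is free, and so is that of `cn` if the
parameter is less than `1`. -/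
lemma exists_jacobi_eq {m σ ε δ : ℝ} (hm : m ≠ 1) (h0 : 0 ≤ σ) (h1 : σ ≤ 1) (h2 : m * σ ≤ 1)
    (hε : ε ^ 2 = 1) (hδ : δ ^ 2 = 1) (hδm : δ = 1 ∨ m < 1) :
    ∃ u, realSn m u = ε * √σ ∧ realCn m u = δ * √(1 - σ) ∧ realDn m u = √(1 - m * σ) := by
  have q0 := Real.sq_sqrt h0
  have q1 := Real.sq_sqrt (sub_nonneg.2 h1)
  have q2 := Real.sq_sqrt (sub_nonneg.2 h2)
  rcases lt_or_gt_of_ne hm with hm' | hm'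
  · obtain ⟨u, hS, hC⟩ := exists_realSn_realCn (m := m) (S := ε * √σ) (C := δ * √(1 - σ)) hm'
      (by rw [mul_pow, mul_pow, hε, hδ, q0, q1]; ring)
    refine ⟨u, hS, hC, ?_⟩
    have := realDn_sq_add (m := m) u
    rw [hS, mul_pow, hε, q0] at this
    rw [eq_comm, Real.sqrt_eq_iff_eq_sq (sub_nonneg.2 h2) (realDn_pos hm' u).le]
    linarith
  · obtain ⟨u, hS, hD⟩ := exists_realSn_realDn (m := m) (S := ε * √σ) (D := √(1 - m * σ)) hm'
      (by rw [mul_pow, hε, q0, q2]; ring)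
    refine ⟨u, hS, ?_, hD⟩
    have := realSn_sq_add_realCn_sq hm u
    rw [hS, mul_pow, hε, q0] at this
    rw [hδm.resolve_right hm'.not_gt, one_mul, eq_comm,
      Real.sqrt_eq_iff_eq_sq (sub_nonneg.2 h1) (realCn_pos hm' u).le]
    linarith

lemma exists_sign (X : ℝ) : ∃ ε : ℝ, ε ^ 2 = 1 ∧ ε * |X| = X := by
  rcases abs_cases X with ⟨h, -⟩ | ⟨h, -⟩
  · exact ⟨1, by norm_num, by rw [h, one_mul]⟩
  · exact ⟨-1, by norm_num, by rw [h]; ring⟩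

/-- Every point of the unit sphere is of the form `(cn u cn' v, sn u dn' v, dn u sn' v)`. -/
lemma exists_sphere_point {m X Y Z : ℝ} (hm0 : m ≠ 0) (hm1 : m ≠ 1)
    (h : X ^ 2 + Y ^ 2 + Z ^ 2 = 1) :
    ∃ u v, realCn m u * realCn (1 - m) v = X ∧ realSn m u * realDn (1 - m) v = Y ∧
      realDn m u * realSn (1 - m) v = Z := by
  obtain ⟨σ, τ, ⟨s0, s1, s2⟩, ⟨t0, t1, t2⟩, hX, hY, hZ⟩ := exists_spheroconal hm0 hm1 h
  obtain ⟨εX, eX, eX'⟩ := exists_sign X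
  obtain ⟨εY, eY, eY'⟩ := exists_sign Y
  obtain ⟨εZ, eZ, eZ'⟩ := exists_sign Z
  have rX : √(1 - σ) * √(1 - τ) = |X| := by
    rw [← Real.sqrt_mul (sub_nonneg.2 s1), hX, Real.sqrt_sq_eq_abs]
  have rY : √σ * √(1 - (1 - m) * τ) = |Y| := by
    rw [← Real.sqrt_mul s0, hY, Real.sqrt_sq_eq_abs]
  have rZ : √(1 - m * σ) * √τ = |Z| := by
    rw [← Real.sqrt_mul (sub_nonneg.2 s2), hZ, Real.sqrt_sq_eq_abs]
  obtain ⟨δ, δ', hδ, hδ', hδδ, hm, hm'⟩ : ∃ δ δ' : ℝ, δ ^ 2 = 1 ∧ δ' ^ 2 = 1 ∧ δ * δ' = εX ∧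
      (δ = 1 ∨ m < 1) ∧ (δ' = 1 ∨ 1 - m < 1) := by
    rcases lt_or_gt_of_ne hm1 with hm | hm
    · exact ⟨εX, 1, eX, by norm_num, by ring, .inr hm, .inl rfl⟩
    · exact ⟨1, εX, by norm_num, eX, by ring, .inl rfl, .inr (by linarith)⟩
  obtain ⟨u, hS, hC, hD⟩ := exists_jacobi_eq hm1 s0 s1 s2 eY hδ hm
  obtain ⟨v, hs, hc, hd⟩ := exists_jacobi_eq (one_sub_ne_one hm0) t0 t1 t2 eZ hδ' hm'
  refine ⟨u, v, ?_, ?_, ?_⟩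
  · rw [hC, hc, ← eX', ← rX, ← hδδ]; ring
  · rw [hS, hd, ← eY', ← rY]; ring
  · rw [hD, hs, ← eZ', ← rZ]; ring

lemma image_hyperboloidParam {a b c m : ℝ} (ha : a ≠ 0) (hb : b ≠ 0) (hc : c ≠ 0) (hm0 : m ≠ 0)
    (hm1 : m ≠ 1) : hyperboloidParam a b c m '' paramDomain m = twoSheetedHyperboloid a b c := by
  ext P
  simp only [Set.mem_image, twoSheetedHyperboloid, Set.mem_ofPred_eq]
  constructor
  · rintro ⟨z, hz, rfl⟩
    have hD0 : realDn m z.re ≠ 0 := left_ne_zero_of_mul hz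
    have hs0 : realSn (1 - m) z.im ≠ 0 := right_ne_zero_of_mul hz
    have := sphere_identity hm0 hm1 z.re z.im
    simp [hyperboloidParam]
    field_simp
    linear_combination this
  · intro hP
    have hw : P 2 / c ≠ 0 := by
      intro h0
      rw [h0] at hP
      nlinarith [sq_nonneg (P 0 / a), sq_nonneg (P 1 / b)]
    have hP2 : P 2 ≠ 0 := (div_ne_zero_iff.1 hw).1
    obtain ⟨u, v, hX, hY, hZ⟩ := exists_sphere_point (X := P 0 / a / (P 2 / c))
      (Y := P 1 / b / (P 2 / c)) (Z := 1 / (P 2 / c)) hm0 hm1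
      (by rw [div_pow (P 0 / a), div_pow (P 1 / b), div_pow 1, one_pow, ← add_div, ← add_div, hP,
        div_self (pow_ne_zero 2 hw)])
    refine ⟨⟨u, v⟩, ?_, ?_⟩
    · change realDn m u * realSn (1 - m) v ≠ 0
      rw [hZ]
      exact one_div_ne_zero hw
    · ext j
      fin_cases j <;>
      · simp only [hyperboloidParam, hZ, mul_assoc, hX, hY]
        simp
        field_simp

/-! ### Curvature lines -/

section Curvature

variable {a b c m : ℝ} {z : ℂ}

/-- If the tangent vectors of `y` are tangent to the hyperboloid at the corresponding point, and
`y_u` is parallel to the `u`-curve of the hyperboloid, then `y` is parametrized conjugately. -/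
lemma det3_dV_dU_eq_zero (hm0 : m ≠ 0) (hm1 : m ≠ 1) (ha : a ≠ 0) (hb : b ≠ 0) (hc : c ≠ 0)
    {y : ℂ → Fin 3 → ℝ} {k l : ℂ → ℝ} (hy : ContDiffAt ℝ ∞ y z)
    (hU : ∀ᶠ w in nhds z, dU y w = k w • paramU a b c m w)
    (hV : dV y z = l z • paramV a b c m z) :
    det3 (dV (dU y) z) (dU y z) (dV y z) = 0 := by
  have hn := dotProduct_fderiv_add (hasFDerivAt_paramNormal hm0 hm1 a b c z)
    (differentiableAt_dU hy) (hU.mono fun w hw => by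
      rw [hw, dotProduct_smul, paramNormal_dot_paramU hm0 hm1 ha hb hc, smul_zero]) Complex.I
  change _ ⬝ᵥ dU y z + _ ⬝ᵥ dV (dU y) z = 0 at hn
  have e : frame (normalU a b m z) (normalV a b m z) Complex.I = normalV a b m z := by
    simp [frame_apply]
  rw [e, hU.self_of_nhds, dotProduct_smul, normalV_dot_paramU ha hb, smul_zero, zero_add] at hn
  refine det3_eq_zero (n := paramNormal a b c m z) ?_ hn ?_ ?_
  · simp [paramNormal, hc]
  · rw [hU.self_of_nhds, dotProduct_smul, paramNormal_dot_paramU hm0 hm1 ha hb hc, smul_zero]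
  · rw [hV, dotProduct_smul, paramNormal_dot_paramV hm0 hm1 ha hb hc, smul_zero]

lemma dU_eq_of_hasFDerivAt {x : ℂ → Fin 3 → ℝ} {P Q : Fin 3 → ℝ} (h : HasFDerivAt x (frame P Q) z) :
    dU x z = P := by
  rw [dU, h.fderiv, frame_apply]
  simp

lemma dV_eq_of_hasFDerivAt {x : ℂ → Fin 3 → ℝ} {P Q : Fin 3 → ℝ} (h : HasFDerivAt x (frame P Q) z) :
    dV x z = Q := by
  rw [dV, h.fderiv, frame_apply]
  simp

lemma mink_smul (k l : ℝ) (X Y : Fin 3 → ℝ) : mink (k • X) (l • Y) = k * l * mink X Y := by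
  simp only [mink, Pi.smul_apply, smul_eq_mul]
  ring

lemma paramU_paramV_minor_ne_zero (ha : a ≠ 0) (hb : b ≠ 0) (hm0 : m ≠ 0) (hm1 : m ≠ 1)
    (hz : z ∈ regularDomain m) :
    paramU a b c m z 0 * paramV a b c m z 1 - paramU a b c m z 1 * paramV a b c m z 0 ≠ 0 := by
  rw [paramU_paramV_minor hm0 hm1 hz.1]
  exact div_ne_zero (mul_ne_zero (mul_ne_zero ha hb) (conformalFactor_pos hm0 hm1 hz).ne')
    (pow_ne_zero 3 hz.1)

lemma isImmersedSurface_hyperboloidParam (ha : a ≠ 0) (hb : b ≠ 0) (hm0 : m ≠ 0) (hm1 : m ≠ 1)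
    {V : Set ℂ} (hsub : V ⊆ regularDomain m) : IsImmersedSurface V (hyperboloidParam a b c m) where
  smooth := fun z hz =>
    (contDiffAt_hyperboloidParam hm0 hm1 a b c (hsub hz).1).contDiffWithinAt
  immersed := fun z hz => by
    rw [(hasFDerivAt_hyperboloidParam hm0 hm1 a b c (hsub hz).1).fderiv]
    exact frame_injective (paramU_paramV_minor_ne_zero ha hb hm0 hm1 (hsub hz))

lemma isCurvatureLineParametrization_hyperboloidParam (ha : a ≠ 0) (hb : b ≠ 0) (hc : c ≠ 0)
    (hm0 : m ≠ 0) (hm1 : m ≠ 1) (hm : (a ^ 2 - c ^ 2) * m = a ^ 2 - b ^ 2) :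
    IsCurvatureLineParametrization (regularDomain m) (hyperboloidParam a b c m) := by
  refine ⟨isImmersedSurface_hyperboloidParam ha hb hm0 hm1 subset_rfl, fun z hz => ⟨?_, ?_⟩⟩
  · have h := hasFDerivAt_hyperboloidParam hm0 hm1 a b c hz.1
    rw [dU_eq_of_hasFDerivAt h, dV_eq_of_hasFDerivAt h, mink_paramU_paramV hm]
  · refine det3_dV_dU_eq_zero (k := fun _ => 1) (l := fun _ => 1) hm0 hm1 ha hb hc
      (contDiffAt_hyperboloidParam hm0 hm1 a b c hz.1) ?_ ?_
    · filter_upwards [(isOpen_paramDomain hm0 hm1).mem_nhds hz.1] with w hw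
      rw [one_smul, dU_eq_of_hasFDerivAt (hasFDerivAt_hyperboloidParam hm0 hm1 a b c hw)]
    · rw [one_smul, dV_eq_of_hasFDerivAt (hasFDerivAt_hyperboloidParam hm0 hm1 a b c hz.1)]

end Curvature

/-! ### The dual is an affine image of a maximal surface -/

section DualSurface

variable {a b c m : ℝ} {p q : ℂ} {V : Set ℂ} {f₁ f₂ f₃ : ℂ → ℂ} {z : ℂ}

lemma isImmersedSurface_dualFormula (ha : a ≠ 0) (hb : b ≠ 0) (hm0 : m ≠ 0) (hm1 : m ≠ 1)
    (hp : p ^ 2 = m) (hq : q ^ 2 = 1 - m) (hV : IsOpen V) (hsub : V ⊆ regularDomain m)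
    (hf : IsBranch m p q V f₁ f₂ f₃) :
    IsImmersedSurface V (dualFormula a b c p q f₁ f₂ f₃) where
  smooth := contDiffOn_dualFormula hm0 hm1 hp hq hV hsub hf
  immersed := fun z hz => by
    rw [(hasFDerivAt_dualFormula hm0 hm1 hp hq hV hsub hf hz).fderiv]
    refine frame_injective ?_
    have h1 := paramU_paramV_minor_ne_zero (c := c) ha hb hm0 hm1 (hsub hz)
    have h2 := (stretch_pos hm0 hm1 (hsub hz)).ne'
    simp only [Pi.smul_apply, smul_eq_mul]
    intro h0
    refine mul_ne_zero (neg_ne_zero.2 (pow_ne_zero 2 h2)) h1 ?_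
    linear_combination h0

lemma isCurvatureLineParametrization_dualFormula (ha : a ≠ 0) (hb : b ≠ 0) (hc : c ≠ 0)
    (hm0 : m ≠ 0) (hm1 : m ≠ 1) (hm : (a ^ 2 - c ^ 2) * m = a ^ 2 - b ^ 2)
    (hp : p ^ 2 = m) (hq : q ^ 2 = 1 - m) (hV : IsOpen V) (hsub : V ⊆ regularDomain m)
    (hf : IsBranch m p q V f₁ f₂ f₃) :
    IsCurvatureLineParametrization V (dualFormula a b c p q f₁ f₂ f₃) := by
  have hi := isImmersedSurface_dualFormula (c := c) ha hb hm0 hm1 hp hq hV hsub hf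
  have h := fun w (hw : w ∈ V) =>
    hasFDerivAt_dualFormula (a := a) (b := b) (c := c) hm0 hm1 hp hq hV hsub hf hw
  refine ⟨hi, fun z hz => ⟨?_, ?_⟩⟩
  · rw [dU_eq_of_hasFDerivAt (h z hz), dV_eq_of_hasFDerivAt (h z hz), mink_smul,
      mink_paramU_paramV hm, mul_zero]
  · refine det3_dV_dU_eq_zero (k := stretch m) (l := fun w => -stretch m w) hm0 hm1 ha hb hc
      (hi.smooth.contDiffAt (hV.mem_nhds hz)) ?_ ?_
    · filter_upwards [hV.mem_nhds hz] with w hw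
      rw [dU_eq_of_hasFDerivAt (h w hw)]
    · rw [dV_eq_of_hasFDerivAt (h z hz)]

lemma isMaximalSurface_dualFormula (hm0 : m ≠ 0) (hm1 : m ≠ 1)
    (hp : p ^ 2 = m) (hq : q ^ 2 = 1 - m) (hV : IsOpen V) (hsub : V ⊆ regularDomain m)
    (hf : IsBranch m p q V f₁ f₂ f₃) : IsMaximalSurface V (dualFormula 1 1 1 p q f₁ f₂ f₃) := by
  have h := fun w (hw : w ∈ V) =>
    hasFDerivAt_dualFormula (a := 1) (b := 1) (c := 1) hm0 hm1 hp hq hV hsub hf hw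
  have hm : ((1 : ℝ) ^ 2 - 1 ^ 2) * m = 1 ^ 2 - 1 ^ 2 := by ring
  -- the common value of the coefficients `E` and `G` of the induced metric
  set g : ℂ → ℝ := fun w => stretch m w ^ 2 * conformalFactor m w
    / (realDn m w.re * realSn (1 - m) w.im) ^ 2 with hg
  have hE : ∀ w ∈ V,
      mink (stretch m w • paramU 1 1 1 m w) (stretch m w • paramU 1 1 1 m w) = g w := by
    intro w hw
    have hD0 : realDn m w.re ≠ 0 := left_ne_zero_of_mul (hsub hw).1
    have hs0 : realSn (1 - m) w.im ≠ 0 := right_ne_zero_of_mul (hsub hw).1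
    rw [mink_smul, mink_paramU_paramU hm0 hm1 hm (hsub hw).1, hg]
    field_simp
    ring
  have hG : ∀ w ∈ V,
      mink (-stretch m w • paramV 1 1 1 m w) (-stretch m w • paramV 1 1 1 m w) = g w := by
    intro w hw
    have hD0 : realDn m w.re ≠ 0 := left_ne_zero_of_mul (hsub hw).1
    have hs0 : realSn (1 - m) w.im ≠ 0 := right_ne_zero_of_mul (hsub hw).1
    rw [mink_smul, mink_paramV_paramV hm0 hm1 hm (hsub hw).1, hg]
    field_simp
    ring
  have hF : ∀ w, mink (stretch m w • paramU 1 1 1 m w) (-stretch m w • paramV 1 1 1 m w) = 0 := by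
    intro w
    rw [mink_smul, mink_paramU_paramV hm, mul_zero]
  refine ⟨isImmersedSurface_dualFormula one_ne_zero one_ne_zero hm0 hm1 hp hq hV hsub hf,
    fun z hz X hX => ?_, fun z hz => ?_⟩
  · rw [(h z hz).fderiv, mink_frame (hE z hz) (hG z hz) (hF z)]
    have h1 := stretch_pos hm0 hm1 (hsub hz)
    have h2 := conformalFactor_pos hm0 hm1 (hsub hz)
    have h3 : realDn m z.re * realSn (1 - m) z.im ≠ 0 := (hsub hz).1
    have h4 : 0 < X.re ^ 2 + X.im ^ 2 := by
      have := Complex.normSq_pos.2 hX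
      rw [Complex.normSq_apply] at this
      linarith
    rw [hg]
    positivity
  · refine meanCurvature_eq_zero ?_ ?_ ?_
    · rw [dU_eq_of_hasFDerivAt (h z hz), dV_eq_of_hasFDerivAt (h z hz), hE z hz, hG z hz]
    · rw [dU_eq_of_hasFDerivAt (h z hz), dV_eq_of_hasFDerivAt (h z hz), hF z]
    · rw [dualFormula_eq]
      exact dU_dU_add_dV_dV_re hV (fun j w hw => (hasDerivAt_dualHolomorphic hm0 hm1 hp hq hV hsub
        hf hw j).differentiableAt.differentiableWithinAt) hz

lemma dualFormula_eq_scaleAxes : dualFormula a b c p q f₁ f₂ f₃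
    = scaleAxes a b c ∘ dualFormula 1 1 1 p q f₁ f₂ f₃ := by
  have e : ∀ (r : ℝ) (s f : ℂ), (2 * r / s * f).re = r * (2 * (1 : ℝ) / s * f).re := by
    intro r s f
    rw [← Complex.re_ofReal_mul]
    congr 1
    push_cast
    ring
  funext z j
  simp only [Function.comp, scaleAxes, LinearMap.coe_toAffineMap, Matrix.toLin'_apply,
    Matrix.mulVec_diagonal]
  fin_cases j
  · exact e a p (f₁ z)
  · exact e b (p * q) (f₂ z)
  · exact e c q (f₃ z)

lemma isChristoffelDual_dualFormula (ha : a ≠ 0) (hb : b ≠ 0)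
    (hm0 : m ≠ 0) (hm1 : m ≠ 1) (hm : (a ^ 2 - c ^ 2) * m = a ^ 2 - b ^ 2)
    (hp : p ^ 2 = m) (hq : q ^ 2 = 1 - m) (hV : IsOpen V) (hsub : V ⊆ regularDomain m)
    (hf : IsBranch m p q V f₁ f₂ f₃) :
    IsChristoffelDual V (hyperboloidParam a b c m) (dualFormula a b c p q f₁ f₂ f₃) where
  surface := isImmersedSurface_hyperboloidParam ha hb hm0 hm1 hsub
  surface_dual := isImmersedSurface_dualFormula ha hb hm0 hm1 hp hq hV hsub hf
  parallel_reversing := fun z hz => by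
    have h2 := (stretch_pos hm0 hm1 (hsub hz))
    refine ⟨stretch m z • Complex.conjCLE.toContinuousLinearMap, ?_, ?_⟩
    · rw [det_eq]
      simp [-mul_neg]
      nlinarith
    · rw [(hasFDerivAt_dualFormula hm0 hm1 hp hq hV hsub hf hz).fderiv,
        (hasFDerivAt_hyperboloidParam hm0 hm1 a b c (hsub hz).1).fderiv]
      ext X j
      simp [frame_apply]
      ring
  conformal := fun z hz => by
    refine ⟨stretch m z ^ 2, pow_pos (stretch_pos hm0 hm1 (hsub hz)) 2, fun X Y => ?_⟩
    rw [(hasFDerivAt_dualFormula hm0 hm1 hp hq hV hsub hf hz).fderiv,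
      (hasFDerivAt_hyperboloidParam hm0 hm1 a b c (hsub hz).1).fderiv]
    have hF := mink_paramU_paramV (z := z) hm
    simp only [mink, frame_apply, Pi.add_apply, Pi.smul_apply, smul_eq_mul] at hF ⊢
    linear_combination (-2 * stretch m z ^ 2 * (X.re * Y.im + X.im * Y.re)) * hF

end DualSurface

/-! ### Uniqueness of the Christoffel dual -/

/-- A conformal orientation reversing correspondence of two tangent planes with an orthogonal basis
`U`, `W` of unequal lengths is diagonal if its matrix `(s, t; t, r)` in this basis is symmetric. -/
lemma diagonal_of_conformal {s t r l E G : ℝ} (hEG : E ≠ G) (hl : 0 < l) (hdet : s * r - t * t < 0)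
    (h1 : s ^ 2 * E + t ^ 2 * G = l * E) (h2 : t ^ 2 * E + r ^ 2 * G = l * G)
    (h3 : t * (s * E + r * G) = 0) : t = 0 ∧ (E ≠ 0 → G ≠ 0 → r = -s) := by
  have ht : t = 0 := by
    by_contra ht
    have h4 : s * E + r * G = 0 := (mul_eq_zero.1 h3).resolve_left ht
    have h5 : (E - G) * (E + G) = 0 := by
      have : l * ((E - G) * (E + G)) = 0 := by
        linear_combination (-E) * h1 + G * h2 + (s * E - r * G) * h4
      exact (mul_eq_zero.1 this).resolve_left hl.ne'
    have h6 : G = -E := by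
      have := (mul_eq_zero.1 h5).resolve_left (sub_ne_zero.2 hEG)
      linarith
    have hE : E ≠ 0 := fun hE => hEG (by rw [h6, hE, neg_zero])
    subst h6
    have h7 : s = r := by
      have : (s - r) * E = 0 := by linear_combination h4
      exact sub_eq_zero.1 ((mul_eq_zero.1 this).resolve_right hE)
    have h8 : s ^ 2 - t ^ 2 = l := by
      have : (s ^ 2 - t ^ 2 - l) * E = 0 := by linear_combination h1
      exact sub_eq_zero.1 ((mul_eq_zero.1 this).resolve_right hE)
    subst h7
    nlinarith
  refine ⟨ht, fun hE hG => ?_⟩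
  subst ht
  have h4 : s ^ 2 = l := mul_right_cancel₀ hE (by linarith)
  have h5 : r ^ 2 = l := mul_right_cancel₀ hG (by linarith)
  have h6 : (r - s) * (r + s) = 0 := by linear_combination h5 - h4
  rcases mul_eq_zero.1 h6 with h7 | h7
  · have : r = s := by linarith
    subst this
    nlinarith
  · linarith

section Uniqueness

variable {a b c m : ℝ} {V : Set ℂ} {y : ℂ → Fin 3 → ℝ} {z : ℂ}

lemma mink_paramU_ne_mink_paramV (hm0 : m ≠ 0) (hm1 : m ≠ 1)
    (hm : (a ^ 2 - c ^ 2) * m = a ^ 2 - b ^ 2) (hac : a ^ 2 - c ^ 2 ≠ 0)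
    (hz : z ∈ regularDomain m) :
    mink (paramU a b c m z) (paramU a b c m z) ≠ mink (paramV a b c m z) (paramV a b c m z) := by
  rw [mink_paramU_paramU hm0 hm1 hm hz.1, mink_paramV_paramV hm0 hm1 hm hz.1]
  have hD0 : realDn m z.re ≠ 0 := left_ne_zero_of_mul hz.1
  have hs0 : realSn (1 - m) z.im ≠ 0 := right_ne_zero_of_mul hz.1
  have hW := (conformalFactor_pos hm0 hm1 hz).ne'
  have h2 := realDn_sq_add (m := m) z.re
  intro h
  rw [div_eq_div_iff (mul_ne_zero (pow_ne_zero 4 hD0) (pow_ne_zero 2 hs0))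
    (mul_ne_zero (pow_ne_zero 2 hD0) (pow_ne_zero 4 hs0))] at h
  -- the difference of the two coefficients is a multiple of the square of the conformal factor
  have hW2 : conformalFactor m z = realDn m z.re ^ 2 - (1 - m) * realSn (1 - m) z.im ^ 2 := by
    unfold conformalFactor
    linear_combination -h2
  refine mul_ne_zero (mul_ne_zero hac (pow_ne_zero 2 hW))
    (mul_ne_zero (pow_ne_zero 2 hD0) (pow_ne_zero 2 hs0)) ?_
  rw [sq (conformalFactor m z)]
  nth_rewrite 2 [hW2]
  linear_combination -h

lemma frequently_mink_ne_zero (hc : c ≠ 0) (hm0 : m ≠ 0) (hm1 : m ≠ 1)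
    (hm : (a ^ 2 - c ^ 2) * m = a ^ 2 - b ^ 2) (hV : IsOpen V) (hsub : V ⊆ regularDomain m)
    (hz : z ∈ V) : ∃ᶠ w in nhds z, w ∈ V ∧ mink (paramU a b c m w) (paramU a b c m w) ≠ 0 ∧
      mink (paramV a b c m w) (paramV a b c m w) ≠ 0 := by
  refine ((frequently_re_im
    (frequently_realDn_sq_ne hm0 hm1 (-((1 - m) * (a ^ 2 - c ^ 2)) / c ^ 2) z.re)
    (frequently_realSn_sq_ne (one_sub_ne_one hm0) (-(a ^ 2 - c ^ 2) / c ^ 2) z.im)).and_eventually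
      (hV.mem_nhds hz)).mono ?_
  rintro w ⟨⟨h1, h2⟩, hw⟩
  have hW := (conformalFactor_pos hm0 hm1 (hsub hw)).ne'
  have hD0 : realDn m w.re ≠ 0 := left_ne_zero_of_mul (hsub hw).1
  have hs0 : realSn (1 - m) w.im ≠ 0 := right_ne_zero_of_mul (hsub hw).1
  have hc2 : c ^ 2 ≠ 0 := pow_ne_zero 2 hc
  rw [mink_paramU_paramU hm0 hm1 hm (hsub hw).1, mink_paramV_paramV hm0 hm1 hm (hsub hw).1]
  refine ⟨hw, div_ne_zero (mul_ne_zero hW fun h => h1 ?_) (by positivity),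
    div_ne_zero (mul_ne_zero hW fun h => h2 ?_) (by positivity)⟩
  · rw [eq_div_iff hc2]
    linarith
  · rw [eq_div_iff hc2]
    linarith

/-- The principal directions of the hyperboloid are the eigendirections of the correspondence of the
tangent planes, for every Christoffel dual. Off the curves where the induced metric degenerates, the
two eigenvalues are opposite. -/
lemma IsChristoffelDual.exists_smul (ha : a ≠ 0) (hb : b ≠ 0) (hc : c ≠ 0)
    (hm0 : m ≠ 0) (hm1 : m ≠ 1) (hm : (a ^ 2 - c ^ 2) * m = a ^ 2 - b ^ 2)
    (hac : a ^ 2 - c ^ 2 ≠ 0) (hV : IsOpen V) (hsub : V ⊆ regularDomain m)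
    (hy : IsChristoffelDual V (hyperboloidParam a b c m) y) (hz : z ∈ V)
    (hE : mink (paramU a b c m z) (paramU a b c m z) ≠ 0)
    (hG : mink (paramV a b c m z) (paramV a b c m z) ≠ 0) :
    ∃ k : ℝ, dU y z = k • paramU a b c m z ∧ dV y z = -k • paramV a b c m z := by
  have hyd : ContDiffAt ℝ ∞ y z := hy.surface_dual.smooth.contDiffAt (hV.mem_nhds hz)
  have hpar : ∀ w ∈ V, ∃ S : ℂ →L[ℝ] ℂ, S.det < 0 ∧
      dU y w = (S 1).re • paramU a b c m w + (S 1).im • paramV a b c m w ∧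
      dV y w = (S Complex.I).re • paramU a b c m w + (S Complex.I).im • paramV a b c m w := by
    intro w hw
    obtain ⟨S, hS, h⟩ := hy.parallel_reversing w hw
    rw [(hasFDerivAt_hyperboloidParam hm0 hm1 a b c (hsub hw).1).fderiv] at h
    exact ⟨S, hS, by rw [dU, h]; rfl, by rw [dV, h]; rfl⟩
  have hnU : ∀ w ∈ V, paramNormal a b c m w ⬝ᵥ dU y w = 0 := by
    intro w hw
    obtain ⟨S, -, h, -⟩ := hpar w hw
    rw [h, dotProduct_add, dotProduct_smul, dotProduct_smul,
      paramNormal_dot_paramU hm0 hm1 ha hb hc, paramNormal_dot_paramV hm0 hm1 ha hb hc]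
    simp
  have hnV : ∀ w ∈ V, paramNormal a b c m w ⬝ᵥ dV y w = 0 := by
    intro w hw
    obtain ⟨S, -, -, h⟩ := hpar w hw
    rw [h, dotProduct_add, dotProduct_smul, dotProduct_smul,
      paramNormal_dot_paramU hm0 hm1 ha hb hc, paramNormal_dot_paramV hm0 hm1 ha hb hc]
    simp
  obtain ⟨S, hdet, hU, hW⟩ := hpar z hz
  -- the normal component of `y_uv = y_vu`: the correspondence is symmetric for the second
  -- fundamental form of the hyperboloid, for which the coordinates are isothermal
  have hsym : (S Complex.I).re = (S 1).im := by
    have e1 := dotProduct_fderiv_add (hasFDerivAt_paramNormal hm0 hm1 a b c z)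
      (differentiableAt_dU hyd) ((hV.eventually_mem hz).mono hnU) Complex.I
    have e2 := dotProduct_fderiv_add (hasFDerivAt_paramNormal hm0 hm1 a b c z)
      (differentiableAt_dV hyd) ((hV.eventually_mem hz).mono hnV) 1
    change _ ⬝ᵥ dU y z + _ ⬝ᵥ dV (dU y) z = 0 at e1
    change _ ⬝ᵥ dV y z + _ ⬝ᵥ dU (dV y) z = 0 at e2
    have f1 : frame (normalU a b m z) (normalV a b m z) Complex.I = normalV a b m z := by
      simp [frame_apply]
    have f2 : frame (normalU a b m z) (normalV a b m z) 1 = normalU a b m z := by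
      simp [frame_apply]
    rw [f1, hU, dotProduct_add, dotProduct_smul, dotProduct_smul, normalV_dot_paramU ha hb,
      normalV_dot_paramV hm0 hm1 ha hb (hsub hz).1, dV_dU_eq_dU_dV hyd] at e1
    rw [f2, hW, dotProduct_add, dotProduct_smul, dotProduct_smul, normalU_dot_paramV ha hb,
      normalU_dot_paramU hm0 hm1 ha hb (hsub hz).1] at e2
    have h3 : conformalFactor m z / (realDn m z.re * realSn (1 - m) z.im) ≠ 0 :=
      div_ne_zero (conformalFactor_pos hm0 hm1 (hsub hz)).ne' (hsub hz).1
    simp only [smul_eq_mul] at e1 e2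
    exact mul_right_cancel₀ h3 (by linear_combination e2 - e1)
  obtain ⟨l, hl, hconf⟩ := hy.conformal z hz
  have hx := hasFDerivAt_hyperboloidParam hm0 hm1 a b c (hsub hz).1
  have c1 := hconf 1 1
  have c2 := hconf Complex.I Complex.I
  have c3 := hconf 1 Complex.I
  change mink (dU y z) (dU y z) = l * mink (dU _ z) (dU _ z) at c1
  change mink (dV y z) (dV y z) = l * mink (dV _ z) (dV _ z) at c2
  change mink (dU y z) (dV y z) = l * mink (dU _ z) (dV _ z) at c3
  rw [dU_eq_of_hasFDerivAt hx] at c1 c3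
  rw [dV_eq_of_hasFDerivAt hx] at c2 c3
  have hF := mink_paramU_paramV (z := z) hm
  have hne := mink_paramU_ne_mink_paramV hm0 hm1 hm hac (hsub hz)
  rw [det_eq, hsym] at hdet
  rw [hsym] at hW
  rw [hF, hU, hW] at c3
  rw [hU] at c1
  rw [hW] at c2
  have hmink : ∀ (s t s' t' : ℝ) (P Q : Fin 3 → ℝ), mink P Q = 0 →
      mink (s • P + t • Q) (s' • P + t' • Q) = s * s' * mink P P + t * t' * mink Q Q := by
    intro s t s' t' P Q h
    simp only [mink, Pi.add_apply, Pi.smul_apply, smul_eq_mul] at h ⊢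
    linear_combination (s * t' + t * s') * h
  rw [hmink _ _ _ _ _ _ hF] at c1 c2 c3
  obtain ⟨h0, h1⟩ := diagonal_of_conformal hne hl hdet (by rw [sq, sq]; exact c1)
    (by rw [sq, sq]; exact c2) (by linear_combination c3)
  refine ⟨(S 1).re, ?_, ?_⟩
  · rw [hU, h0, zero_smul, add_zero]
  · rw [hW, h0, h1 hE hG, zero_smul, zero_add]

/-- Two surfaces whose differentials are pointwise proportional differ by a homothety and a
translation: the factor `κ` satisfies `κ_v x_u = κ_u x_v`, so it is constant. -/
lemma exists_eq_smul_add {x : ℂ → Fin 3 → ℝ} (hV : IsOpen V) (hc : IsPreconnected V)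
    (hx : IsImmersedSurface V x) (hy : ContDiffOn ℝ ∞ y V) {κ : ℂ → ℝ}
    (hκ : ∀ z ∈ V, DifferentiableAt ℝ κ z) (hU : ∀ z ∈ V, dU y z = κ z • dU x z)
    (hW : ∀ z ∈ V, dV y z = κ z • dV x z) :
    ∃ (k : ℝ) (t : Fin 3 → ℝ), ∀ z ∈ V, κ z = k ∧ y z = k • x z + t := by
  have hxd : ∀ z ∈ V, ContDiffAt ℝ ∞ x z := fun z hz => hx.smooth.contDiffAt (hV.mem_nhds hz)
  have hyd : ∀ z ∈ V, ContDiffAt ℝ ∞ y z := fun z hz => hy.contDiffAt (hV.mem_nhds hz)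
  have hκ0 : V.EqOn (fderiv ℝ κ) 0 := by
    intro z hz
    have e1 : dV (dU y) z = κ z • dV (dU x) z + fderiv ℝ κ z Complex.I • dU x z := by
      have : dU y =ᶠ[nhds z] fun w => κ w • dU x w := (hV.eventually_mem hz).mono hU
      rw [dV, this.fderiv_eq,
        ((hκ z hz).hasFDerivAt.fun_smul (differentiableAt_dU (hxd z hz)).hasFDerivAt).fderiv]
      rfl
    have e2 : dU (dV y) z = κ z • dU (dV x) z + fderiv ℝ κ z 1 • dV x z := by
      have : dV y =ᶠ[nhds z] fun w => κ w • dV x w := (hV.eventually_mem hz).mono hW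
      rw [dU, this.fderiv_eq,
        ((hκ z hz).hasFDerivAt.fun_smul (differentiableAt_dV (hxd z hz)).hasFDerivAt).fderiv]
      rfl
    rw [dV_dU_eq_dU_dV (hyd z hz), dV_dU_eq_dU_dV (hxd z hz), e2] at e1
    have e3 := add_left_cancel e1
    have e4 : fderiv ℝ x z ⟨fderiv ℝ κ z Complex.I, -fderiv ℝ κ z 1⟩ = fderiv ℝ x z 0 := by
      rw [eq_frame (fderiv ℝ x z), frame_apply]
      change fderiv ℝ κ z Complex.I • dU x z + (-fderiv ℝ κ z 1) • dV x z = _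
      rw [neg_smul, e3, map_zero, add_neg_cancel]
    have e5 := hx.immersed z hz e4
    have h1 : fderiv ℝ κ z Complex.I = 0 := congrArg Complex.re e5
    have h2 : -fderiv ℝ κ z 1 = 0 := congrArg Complex.im e5
    ext X
    have e : X = X.re • (1 : ℂ) + X.im • Complex.I := by simp
    rw [e, map_add, map_smul, map_smul, h1, neg_eq_zero.1 h2]
    simp
  obtain ⟨k, hk⟩ := hV.exists_is_const_of_fderiv_eq_zero hc
    (fun z hz => (hκ z hz).differentiableWithinAt) hκ0
  have hxd' : ∀ z ∈ V, DifferentiableAt ℝ x z := fun z hz => (hxd z hz).differentiableAt (by simp)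
  have hyd' : ∀ z ∈ V, DifferentiableAt ℝ y z := fun z hz => (hyd z hz).differentiableAt (by simp)
  obtain ⟨t, ht⟩ := hV.exists_is_const_of_fderiv_eq_zero (𝕜 := ℝ) (f := fun w => y w - k • x w) hc
    (fun z hz => ((hyd' z hz).sub ((hxd' z hz).const_smul k)).differentiableWithinAt) (by
      intro z hz
      rw [((hyd' z hz).hasFDerivAt.fun_sub ((hxd' z hz).hasFDerivAt.fun_const_smul k)).fderiv,
        eq_frame (fderiv ℝ y z)]
      change frame (dU y z) (dV y z) - _ = 0
      rw [hU z hz, hW z hz, hk z hz]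
      ext1 X
      have e : X = X.re • (1 : ℂ) + X.im • Complex.I := by simp
      rw [sub_apply, FunLike.coe_smul, Pi.smul_apply, eq_frame (fderiv ℝ x z), frame_apply,
        frame_apply]
      change X.re • k • dU x z + X.im • k • dV x z - k • (X.re • dU x z + X.im • dV x z) = 0
      rw [smul_add, smul_comm k, smul_comm k, sub_self])
  refine ⟨k, t, fun z hz => ⟨hk z hz, ?_⟩⟩
  rw [← ht z hz]
  simp

/-- The proportionality of the differentials, known where the induced metric is nondegenerate,
extends by continuity: the factor `κ` is obtained from the Euclidean inner product, so that it is
differentiable. -/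
lemma exists_eq_smul_dualFormula_add (ha : a ≠ 0) (hb : b ≠ 0) (hc : c ≠ 0)
    (hm0 : m ≠ 0) (hm1 : m ≠ 1) (hm : (a ^ 2 - c ^ 2) * m = a ^ 2 - b ^ 2)
    (hac : a ^ 2 - c ^ 2 ≠ 0) {p q : ℂ} {f₁ f₂ f₃ : ℂ → ℂ}
    (hp : p ^ 2 = m) (hq : q ^ 2 = 1 - m) (hV : IsOpen V) (hconn : IsConnected V)
    (hsub : V ⊆ regularDomain m) (hf : IsBranch m p q V f₁ f₂ f₃)
    (hy : IsChristoffelDual V (hyperboloidParam a b c m) y) :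
    ∃ k : ℝ, k ≠ 0 ∧ ∃ t : Fin 3 → ℝ, ∀ z ∈ V, y z = k • dualFormula a b c p q f₁ f₂ f₃ z + t := by
  have hxi := isImmersedSurface_dualFormula (c := c) ha hb hm0 hm1 hp hq hV hsub hf
  have hx := fun w (hw : w ∈ V) =>
    hasFDerivAt_dualFormula (a := a) (b := b) (c := c) hm0 hm1 hp hq hV hsub hf hw
  set x := dualFormula a b c p q f₁ f₂ f₃
  have hxd : ∀ z ∈ V, ContDiffAt ℝ ∞ x z := fun z hz => hxi.smooth.contDiffAt (hV.mem_nhds hz)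
  have hyd : ∀ z ∈ V, ContDiffAt ℝ ∞ y z := fun z hz =>
    hy.surface_dual.smooth.contDiffAt (hV.mem_nhds hz)
  have hx0 : ∀ z ∈ V, dU x z ⬝ᵥ dU x z ≠ 0 := by
    intro z hz h0
    have h1 : fderiv ℝ x z 1 = fderiv ℝ x z 0 := by
      rw [map_zero]
      exact dotProduct_self_eq_zero.1 h0
    exact one_ne_zero (hxi.immersed z hz h1)
  set κ : ℂ → ℝ := fun z => (dU y z ⬝ᵥ dU x z) / (dU x z ⬝ᵥ dU x z)
  have hdot : ∀ z (X Y : ℂ → Fin 3 → ℝ), DifferentiableAt ℝ X z → DifferentiableAt ℝ Y z →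
      DifferentiableAt ℝ (fun w => X w ⬝ᵥ Y w) z := by
    intro z X Y hX hY
    rw [differentiableAt_pi] at hX hY
    simp only [dotProduct, Fin.sum_univ_three]
    exact (((hX 0).mul (hY 0)).add ((hX 1).mul (hY 1))).add ((hX 2).mul (hY 2))
  have hκ : ∀ z ∈ V, DifferentiableAt ℝ κ z := by
    intro z hz
    have h1 : DifferentiableAt ℝ (fun w => dU y w ⬝ᵥ dU x w) z :=
      hdot z _ _ (differentiableAt_dU (hyd z hz)) (differentiableAt_dU (hxd z hz))
    have h2 : DifferentiableAt ℝ (fun w => dU x w ⬝ᵥ dU x w) z :=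
      hdot z _ _ (differentiableAt_dU (hxd z hz)) (differentiableAt_dU (hxd z hz))
    exact h1.fun_mul (h2.fun_inv (hx0 z hz))
  -- the differentials are proportional off the degenerate curves, hence everywhere
  have hgen : ∀ z ∈ V, mink (paramU a b c m z) (paramU a b c m z) ≠ 0 →
      mink (paramV a b c m z) (paramV a b c m z) ≠ 0 →
      dU y z - κ z • dU x z = 0 ∧ dV y z - κ z • dV x z = 0 := by
    intro z hz hE hG
    obtain ⟨k, hkU, hkV⟩ := hy.exists_smul ha hb hc hm0 hm1 hm hac hV hsub hz hE hG
    have hs := (stretch_pos hm0 hm1 (hsub hz)).ne'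
    have e1 : dU y z = (k / stretch m z) • dU x z := by
      rw [dU_eq_of_hasFDerivAt (hx z hz), smul_smul, div_mul_cancel₀ _ hs, hkU]
    have e2 : dV y z = (k / stretch m z) • dV x z := by
      rw [dV_eq_of_hasFDerivAt (hx z hz), smul_smul, mul_neg, div_mul_cancel₀ _ hs, hkV]
    have e3 : κ z = k / stretch m z := by
      change (dU y z ⬝ᵥ dU x z) / (dU x z ⬝ᵥ dU x z) = _
      rw [e1, smul_dotProduct, smul_eq_mul, mul_div_cancel_right₀ _ (hx0 z hz)]
    rw [e3, ← e1, ← e2, sub_self, sub_self]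
    exact ⟨rfl, rfl⟩
  have hall : ∀ z ∈ V, dU y z = κ z • dU x z ∧ dV y z = κ z • dV x z := by
    intro z hz
    have hfr := frequently_mink_ne_zero hc hm0 hm1 hm hV hsub hz
    have cU : ContinuousAt (fun w => dU y w - κ w • dU x w) z :=
      (differentiableAt_dU (hyd z hz)).continuousAt.sub
        ((hκ z hz).continuousAt.smul (differentiableAt_dU (hxd z hz)).continuousAt)
    have cV : ContinuousAt (fun w => dV y w - κ w • dV x w) z :=
      (differentiableAt_dV (hyd z hz)).continuousAt.sub
        ((hκ z hz).continuousAt.smul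
          (differentiableAt_dV (hxd z hz)).continuousAt)
    constructor
    · by_contra h
      obtain ⟨w, ⟨hw, hE, hG⟩, hne⟩ :=
        (hfr.and_eventually (cU.eventually_ne (sub_ne_zero.2 h))).exists
      exact hne (hgen w hw hE hG).1
    · by_contra h
      obtain ⟨w, ⟨hw, hE, hG⟩, hne⟩ :=
        (hfr.and_eventually (cV.eventually_ne (sub_ne_zero.2 h))).exists
      exact hne (hgen w hw hE hG).2
  obtain ⟨k, t, h⟩ := exists_eq_smul_add hV hconn.isPreconnected hxi hy.surface_dual.smooth hκ
    (fun z hz => (hall z hz).1) (fun z hz => (hall z hz).2)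
  refine ⟨k, ?_, t, fun z hz => (h z hz).2⟩
  rintro rfl
  obtain ⟨z, hz⟩ := hconn.nonempty
  have h0 : fderiv ℝ y z 1 = fderiv ℝ y z 0 := by
    rw [map_zero]
    change dU y z = 0
    rw [(hall z hz).1, (h z hz).1, zero_smul]
  exact one_ne_zero (hy.surface_dual.immersed z hz h0)

end Uniqueness

end Hyperboloid

end

theorem mainTheorem4 (a b c : ℝ) (ha : 0 < a) (hb : 0 < b) (hc : 0 < c)
    (h : (a > b ∧ b > c) ∨ (c > a ∧ a > b) ∨ (b > c ∧ c > a))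
    (m : ℝ) (hm : m = (a ^ 2 - b ^ 2) / (a ^ 2 - c ^ 2))
    (p q : ℂ) (hp : p ^ 2 = (((a ^ 2 - b ^ 2) / (a ^ 2 - c ^ 2) : ℝ) : ℂ))
    (hq : q ^ 2 = (((b ^ 2 - c ^ 2) / (a ^ 2 - c ^ 2) : ℝ) : ℂ)) :
    -- the Jacobi functions of modulus `p` parametrize the hyperboloid, by curvature lines
    -- away from the zeros of `dn`
    Hyperboloid.hyperboloidParam a b c m '' Hyperboloid.paramDomain m
        = Hyperboloid.twoSheetedHyperboloid a b c ∧
    Hyperboloid.IsCurvatureLineParametrization (Hyperboloid.regularDomain m)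
        (Hyperboloid.hyperboloidParam a b c m) ∧
    -- the multivalued functions in the formula have branches on simply connected domains
    (∀ V : Set ℂ, IsOpen V → SimplyConnectedSpace V → V ⊆ Hyperboloid.regularDomain m →
      ∃ f₁ f₂ f₃ : ℂ → ℂ, Hyperboloid.IsBranch m p q V f₁ f₂ f₃) ∧
    -- and for all branches on connected domains the formula gives the Christoffel dual
    (∀ V : Set ℂ, IsOpen V → IsConnected V → V ⊆ Hyperboloid.regularDomain m →
      ∀ f₁ f₂ f₃ : ℂ → ℂ, Hyperboloid.IsBranch m p q V f₁ f₂ f₃ →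
        -- an affine image of a maximal surface
        Hyperboloid.IsMaximalSurface V (Hyperboloid.dualFormula 1 1 1 p q f₁ f₂ f₃) ∧
        Hyperboloid.dualFormula a b c p q f₁ f₂ f₃
          = Hyperboloid.scaleAxes a b c ∘ Hyperboloid.dualFormula 1 1 1 p q f₁ f₂ f₃ ∧
        -- a Christoffel dual of the hyperboloid, with the same curvature line parameters
        Hyperboloid.IsChristoffelDual V (Hyperboloid.hyperboloidParam a b c m)
          (Hyperboloid.dualFormula a b c p q f₁ f₂ f₃) ∧
        Hyperboloid.IsCurvatureLineParametrization V
          (Hyperboloid.dualFormula a b c p q f₁ f₂ f₃) ∧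
        -- the only one, up to homothety and translation
        ∀ y : ℂ → Fin 3 → ℝ,
          Hyperboloid.IsChristoffelDual V (Hyperboloid.hyperboloidParam a b c m) y →
          ∃ k : ℝ, k ≠ 0 ∧ ∃ t : Fin 3 → ℝ, ∀ z ∈ V,
            y z = k • Hyperboloid.dualFormula a b c p q f₁ f₂ f₃ z + t) := by
  have hne : ∀ {x y : ℝ}, 0 < x → 0 < y → x ≠ y → x ^ 2 - y ^ 2 ≠ 0 := fun hx hy hxy =>
    sub_ne_zero.2 fun e => hxy ((pow_left_inj₀ hx.le hy.le two_ne_zero).1 e)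
  have hab : a ^ 2 - b ^ 2 ≠ 0 := hne ha hb <| by
    rcases h with h | h | h <;> intro e <;> linarith
  have hbc : b ^ 2 - c ^ 2 ≠ 0 := hne hb hc <| by
    rcases h with h | h | h <;> intro e <;> linarith
  have hac : a ^ 2 - c ^ 2 ≠ 0 := hne ha hc <| by
    rcases h with h | h | h <;> intro e <;> linarith
  have hm' : (a ^ 2 - c ^ 2) * m = a ^ 2 - b ^ 2 := by rw [hm, mul_div_cancel₀ _ hac]
  have hm0 : m ≠ 0 := by
    rw [hm]
    exact div_ne_zero hab hac
  have hq' : (b ^ 2 - c ^ 2) / (a ^ 2 - c ^ 2) = 1 - m := by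
    rw [div_eq_iff hac]
    linarith
  have hm1 : m ≠ 1 := by
    rintro rfl
    exact div_ne_zero hbc hac (by rw [hq', sub_self])
  rw [← hm] at hp
  rw [hq', Complex.ofReal_sub, Complex.ofReal_one] at hq
  refine ⟨Hyperboloid.image_hyperboloidParam ha.ne' hb.ne' hc.ne' hm0 hm1,
    Hyperboloid.isCurvatureLineParametrization_hyperboloidParam ha.ne' hb.ne' hc.ne' hm0 hm1 hm',
    fun V hV hs hsub => Hyperboloid.exists_isBranch hm0 hm1 hp hq hV hs hsub,
    fun V hV hconn hsub f₁ f₂ f₃ hf =>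
      ⟨Hyperboloid.isMaximalSurface_dualFormula hm0 hm1 hp hq hV hsub hf,
        Hyperboloid.dualFormula_eq_scaleAxes,
        Hyperboloid.isChristoffelDual_dualFormula ha.ne' hb.ne' hm0 hm1 hm' hp hq hV hsub hf,
        Hyperboloid.isCurvatureLineParametrization_dualFormula ha.ne' hb.ne' hc.ne' hm0 hm1 hm'
          hp hq hV hsub hf,
        fun y hy => Hyperboloid.exists_eq_smul_dualFormula_add ha.ne' hb.ne' hc.ne' hm0 hm1 hm'
          hac hp hq hV hconn hsub hf hy⟩⟩
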